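/- Let $G$ be a finite degree-one graph, that is, a graph in which every vertex is incident to exactly one edge, and let $D$ be a straight-line drawing of $G$ in the plane: vertices are distinct points, each edge is the line segment between its two endpoints, no vertex lies on an edge of which it is not an endpoint, and no point lies in three edges. A \emph{crossing} is a point common to two distinct edges. A \emph{casing} of $D$ chooses, independently for each crossing, which of its two edges is drawn on top; the crossing is a \emph{bridge} for the top edge and a \emph{tunnel} for the other one. A \emph{switch} is a pair of consecutive crossings along an edge $e$, one of which is a bridge for $e$ and the other a tunnel for $e$. The \emph{segments} of the arrangement are the pieces into which the edges are divided by the crossings, and the \emph{faces} are the connected components of the complement in $\mathbb{R}^2$ of the union of the edges. The \emph{face polygon} of a bounded face $F$ is the boundary $\partial\overline{F}$ of the closure of $F$ (it has several components if the region $\overline F$ has holes). Its \emph{complexity} is the number of segments of the arrangement contained in $\partial\overline{F}$ plus the number of vertices of $G$ in the interior of $\overline{F}$, and it is \emph{odd} if its complexity is an odd number. Then $D$ has a casing with no switches if and only if $D$ has no odd face polygon. -/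

import Mathlib

/-- The Euclidean plane. -/
abbrev Plane : Type := EuclideanSpace ℝ (Fin 2)

/-- A degree-one graph: every vertex is incident to exactly one edge. -/
def IsDegreeOneGraph {V : Type*} (G : SimpleGraph V) : Prop :=
  ∀ v : V, ∃! e : Sym2 V, e ∈ G.edgeSet ∧ v ∈ e

/-- A straight-line drawing of `G` in the plane: vertices go to distinct points, the edge `uv` is
drawn as the line segment between the points of `u` and `v`, no vertex lies on an edge unless it
is an endpoint of that edge, and no more than two edges cross in one point. -/
structure StraightLineDrawing {V : Type*} (G : SimpleGraph V) where
  pos : V → Plane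
  pos_injective : Function.Injective pos
  /-- No vertex lies on an edge of which it is not an endpoint. -/
  mem_of_pos_mem : ∀ e ∈ G.edgeSet, ∀ v : V,
    pos v ∈ convexHull ℝ (pos '' {u | u ∈ e}) → v ∈ e
  /-- A point that is not a vertex lies on at most two edges. -/
  no_triple_crossing : ∀ e₁ ∈ G.edgeSet, ∀ e₂ ∈ G.edgeSet, ∀ e₃ ∈ G.edgeSet,
    e₁ ≠ e₂ → e₁ ≠ e₃ → e₂ ≠ e₃ → ∀ p : Plane, p ∉ Set.range pos →
    ¬ (p ∈ convexHull ℝ (pos '' {u | u ∈ e₁}) ∧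
       p ∈ convexHull ℝ (pos '' {u | u ∈ e₂}) ∧
       p ∈ convexHull ℝ (pos '' {u | u ∈ e₃}))

namespace StraightLineDrawing

variable {V : Type*} {G : SimpleGraph V} (D : StraightLineDrawing G)

/-- The line segment that draws the edge `e`. -/
def edgeSegment (e : G.edgeSet) : Set Plane :=
  convexHull ℝ (D.pos '' {u | u ∈ (e : Sym2 V)})

/-- The crossings of the drawing: the points, other than vertices, that lie on two distinct edges.
By the general position assumptions, such a point lies on exactly two edges, and two distinct edges
have at most one of them in common. -/
def crossings : Set Plane :=
  {p | p ∉ Set.range D.pos ∧ ∃ e f : G.edgeSet, e ≠ f ∧ p ∈ D.edgeSegment e ∧ p ∈ D.edgeSegment f}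

/-- A casing in the weaving model: independently for every crossing, one of the (two) edges through
it is chosen to be drawn on top. -/
def Casing : Type _ :=
  (C : D.crossings) → {e : G.edgeSet // (C : Plane) ∈ D.edgeSegment e}

/-- The crossing `C` is a bridge for `e`: it lies on `e`, and `e` is on top there. -/
def IsBridge (c : D.Casing) (e : G.edgeSet) (C : D.crossings) : Prop :=
  (C : Plane) ∈ D.edgeSegment e ∧ (c C : G.edgeSet) = e

/-- The crossing `C` is a tunnel for `e`: it lies on `e`, and the other edge is on top there. -/
def IsTunnel (c : D.Casing) (e : G.edgeSet) (C : D.crossings) : Prop :=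
  (C : Plane) ∈ D.edgeSegment e ∧ (c C : G.edgeSet) ≠ e

/-- `C₁` and `C₂` are consecutive crossings along the edge `e`. -/
def Consecutive (e : G.edgeSet) (C₁ C₂ : D.crossings) : Prop :=
  (C₁ : Plane) ∈ D.edgeSegment e ∧ (C₂ : Plane) ∈ D.edgeSegment e ∧ C₁ ≠ C₂ ∧
    ∀ C : D.crossings, ¬ Sbtw ℝ (C₁ : Plane) (C : Plane) (C₂ : Plane)

/-- The pair of crossings `(C₁, C₂)` is a switch along the edge `e`. -/
def IsSwitch (c : D.Casing) (e : G.edgeSet) (C₁ C₂ : D.crossings) : Prop :=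
  D.Consecutive e C₁ C₂ ∧
    ((D.IsBridge c e C₁ ∧ D.IsTunnel c e C₂) ∨ (D.IsTunnel c e C₁ ∧ D.IsBridge c e C₂))

/-- The casing has no switches. -/
def Casing.HasNoSwitches {D : StraightLineDrawing G} (c : D.Casing) : Prop :=
  ∀ (e : G.edgeSet) (C₁ C₂ : D.crossings), ¬ D.IsSwitch c e C₁ C₂

/-- The nodes of the arrangement of the drawn edges: graph vertices and crossings. -/
def nodes : Set Plane :=
  Set.range D.pos ∪ D.crossings

/-- The segments of the arrangement: the pieces of the edges between consecutive nodes. -/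
def arrangementSegments : Set (Set Plane) :=
  {s | ∃ (e : G.edgeSet) (a b : Plane), a ∈ D.nodes ∧ b ∈ D.nodes ∧
    a ∈ D.edgeSegment e ∧ b ∈ D.edgeSegment e ∧ a ≠ b ∧
    (∀ x ∈ D.nodes, ¬ Sbtw ℝ a x b) ∧ s = segment ℝ a b}

/-- The faces of the arrangement: the connected components of the complement of the union of the
drawn edges. -/
def IsFace (F : Set Plane) : Prop :=
  ∃ x ∈ (⋃ e : G.edgeSet, D.edgeSegment e)ᶜ,
    F = connectedComponentIn (⋃ e : G.edgeSet, D.edgeSegment e)ᶜ x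

/-- The polygon of a face: the boundary of the closure of the face. (Parts of edges that have the
face on both sides lie in the interior of the closure, and do not belong to it.) -/
def facePolygon (F : Set Plane) : Set Plane :=
  frontier (closure F)

/-- The region inside the polygon of a face. -/
def facePolygonInterior (F : Set Plane) : Set Plane :=
  interior (closure F)

/-- The complexity of the polygon of the face `F`: the number of segments of the arrangement that
form it, plus the number of graph vertices inside it. -/
noncomputable def faceComplexity (F : Set Plane) : ℕ :=
  {s | s ∈ D.arrangementSegments ∧ s ⊆ facePolygon F}.ncard +
    {v : V | D.pos v ∈ facePolygonInterior F}.ncard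

/-- The bounded face `F` has an odd face polygon. -/
def IsOddFacePolygon (F : Set Plane) : Prop :=
  D.IsFace F ∧ Bornology.IsBounded F ∧ Odd (D.faceComplexity F)

end StraightLineDrawing

open Set Filter Topology

/-! A casing without switches puts an edge on top at all of its crossings or at none. Such casings
amount to proper 2-colourings of the crossing graph, whose vertices are the edges of `G`, adjacent
when they cross (`exists_hasNoSwitches_iff`). So it has to be shown that this graph is bipartite
exactly when no bounded face has odd complexity.

Complexity is first traded for corners: each crossing has four sectors, and the corners of `F` there
are the sectors filled by `F`. Consider the sides, lying in `F`, of the pieces of one edge. Each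
side has two ends, and an end is either a corner of `F` at a crossing or lies at a vertex in the
interior of the closure of `F`, around which both sides belong to `F`. Hence twice the number of
sides is twice the number of such vertices plus the number of corners along the edge
(`two_mul_sum_sideCount`). Summed over all edges, every corner is met twice; a piece is on the face
polygon iff exactly one of its sides is in `F`. So complexity and number of corners have the same
parity (`complexity_mod_two`). The identity also shows that the corners along a single edge are even
in number. Summing over one colour class meets every crossing once, so a colouring makes the number
of corners even (`even_corners_of_coloring`).

Conversely, a closed walk in the crossing graph is traced by a closed polygonal curve along the
edges. Its winding number `W F` is constant on each face `F` and zero on unbounded faces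
(`exists_winding`). Around a crossing, the four winding numbers add up, modulo 2, to the number of
turns of the walk there: a straight passage contributes an even amount, a turn an odd one
(`sum_winding_mod_two`). Summing over crossings, the length of the walk is congruent to the sum of
`W F` times the number of corners of `F`, which is even if all bounded faces have evenly many
corners. So all closed walks are even and the graph is bipartite (`crossingGraph_colorable`). -/

/-- The cross product of two vectors of the plane. -/
def Plane.cross (u v : Plane) : ℝ := u 0 * v 1 - u 1 * v 0

/-- The dot product of two vectors of the plane. -/
def Plane.dot (u v : Plane) : ℝ := u 0 * v 0 + u 1 * v 1

/-! ### Cross products, half planes and sectors. -/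

namespace Plane

lemma ext_iff' {x y : Plane} : x = y ↔ x 0 = y 0 ∧ x 1 = y 1 := by
  constructor
  · rintro rfl; exact ⟨rfl, rfl⟩
  · rintro ⟨h0, h1⟩
    ext k
    fin_cases k <;> assumption

lemma dot_self_pos {u : Plane} (hu : u ≠ 0) : 0 < dot u u := by
  have h : ¬ (u 0 = 0 ∧ u 1 = 0) := fun h => hu (ext_iff'.2 (by simpa using h))
  unfold dot
  by_contra hc
  exact h ⟨by nlinarith [sq_nonneg (u 0), sq_nonneg (u 1)],
    by nlinarith [sq_nonneg (u 0), sq_nonneg (u 1)]⟩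

lemma dot_self_smul_eq (u v : Plane) (h : cross u v = 0) :
    dot u u • v = dot u v • u := by
  rw [ext_iff']
  simp only [cross, dot, PiLp.smul_apply, smul_eq_mul] at *
  constructor
  · linear_combination (-u 1) * h
  · linear_combination (u 0) * h

lemma eq_smul_of_cross_eq_zero {u v : Plane} (hu : u ≠ 0) (h : cross u v = 0) :
    v = (dot u v / dot u u) • u := by
  have h1 := dot_self_smul_eq u v h
  have h2 := (dot_self_pos hu).ne'
  rw [div_eq_inv_mul, mul_smul, ← h1, smul_smul, inv_mul_cancel₀ h2, one_smul]

@[fun_prop]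
lemma continuous_cross_sub (u x : Plane) : Continuous fun y : Plane => cross u (y - x) := by
  unfold cross
  simp only [PiLp.sub_apply]
  fun_prop

lemma cross_self (u : Plane) : cross u u = 0 := by unfold cross; ring

lemma cross_swap (u v : Plane) : cross u v = - cross v u := by unfold cross; ring

lemma cross_add (u v w : Plane) : cross u (v + w) = cross u v + cross u w := by
  simp only [cross, PiLp.add_apply]; ring

lemma cross_sub (u v w : Plane) : cross u (v - w) = cross u v - cross u w := by
  simp only [cross, PiLp.sub_apply]; ring

lemma cross_smul (c : ℝ) (u v : Plane) : cross u (c • v) = c * cross u v := by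
  simp only [cross, PiLp.smul_apply, smul_eq_mul]; ring

lemma dot_add (u v w : Plane) : dot u (v + w) = dot u v + dot u w := by
  simp only [dot, PiLp.add_apply]; ring

lemma dot_smul (c : ℝ) (u v : Plane) : dot u (c • v) = c * dot u v := by
  simp only [dot, PiLp.smul_apply, smul_eq_mul]; ring

/-- The vector `u` turned by a quarter turn to the left. -/
noncomputable def rot (u : Plane) : Plane := !₂[-u 1, u 0]

lemma cross_rot (u : Plane) : cross u (rot u) = dot u u := by
  simp [cross, dot, rot]

lemma mem_segment_iff {a b y : Plane} (hab : a ≠ b) :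
    y ∈ segment ℝ a b ↔ cross (b - a) (y - a) = 0 ∧ 0 ≤ dot (b - a) (y - a) ∧
      dot (b - a) (y - a) ≤ dot (b - a) (b - a) := by
  have hd : b - a ≠ 0 := sub_ne_zero.2 hab.symm
  have hp := dot_self_pos hd
  rw [segment_eq_image']
  constructor
  · rintro ⟨t, ⟨h0, h1⟩, rfl⟩
    simp only [add_sub_cancel_left, cross_smul, dot_smul, cross_self, mul_zero, true_and]
    exact ⟨by positivity, by nlinarith⟩
  · rintro ⟨h, h0, h1⟩
    refine ⟨dot (b - a) (y - a) / dot (b - a) (b - a),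
      ⟨by positivity, (div_le_one hp).2 h1⟩, ?_⟩
    change a + _ = y
    rw [← eq_smul_of_cross_eq_zero hd h]; abel

/-- The open half plane bounded by the line through `x` in the direction `u`, on the side given
by the sign of `σ`. -/
def halfPlane (σ : ℝ) (u x : Plane) : Set Plane := {y | 0 < σ * cross u (y - x)}

lemma isOpen_halfPlane (σ : ℝ) (u x : Plane) : IsOpen (halfPlane σ u x) :=
  isOpen_lt continuous_const (by fun_prop)

lemma convex_halfPlane (σ : ℝ) (u x : Plane) : Convex ℝ (halfPlane σ u x) := by
  intro y hy z hz a b ha hb hab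
  simp only [halfPlane, mem_ofPred_eq] at *
  have : σ * cross u (a • y + b • z - x) = a * (σ * cross u (y - x)) + b * (σ * cross u (z - x)) := by
    simp only [cross, PiLp.add_apply, PiLp.sub_apply, PiLp.smul_apply, smul_eq_mul]
    linear_combination (σ * (u 0 * x 1 - u 1 * x 0)) * hab
  rw [this]
  rcases ha.eq_or_lt with rfl | ha
  · have : b = 1 := by linarith
    subst this; simpa using hz
  · have := mul_pos ha hy
    have := mul_nonneg hb hz.le
    linarith

lemma halfPlane_add_smul (σ : ℝ) (u x : Plane) (t : ℝ) :
    halfPlane σ u (x + t • u) = halfPlane σ u x := by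
  ext y
  simp only [halfPlane, mem_ofPred_eq]
  have : cross u (y - (x + t • u)) = cross u (y - x) := by
    simp only [cross, PiLp.add_apply, PiLp.sub_apply, PiLp.smul_apply, smul_eq_mul]; ring
  rw [this]

/-- A set that contains arbitrarily short initial pieces of a ray. -/
lemma neBot_of_ray {x w : Plane} {H : Set Plane} (h : ∀ ε : ℝ, 0 < ε → x + ε • w ∈ H) :
    (𝓝[H] x).NeBot := by
  have : Tendsto (fun ε : ℝ => x + ε • w) (𝓝[>] 0) (𝓝[H] x) := by
    refine tendsto_nhdsWithin_iff.2 ⟨?_, ?_⟩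
    · refine tendsto_nhdsWithin_of_tendsto_nhds ?_
      have : Continuous fun ε : ℝ => x + ε • w := by fun_prop
      simpa using this.tendsto 0
    · filter_upwards [self_mem_nhdsWithin] with ε hε using h ε hε
  exact this.neBot

lemma neBot_halfPlane {σ : ℝ} (hσ : σ ≠ 0) {u : Plane} (hu : u ≠ 0) (x : Plane) :
    (𝓝[halfPlane σ u x] x).NeBot := by
  refine neBot_of_ray (w := σ • rot u) fun ε hε => ?_
  simp only [halfPlane, mem_ofPred_eq, add_sub_cancel_left, cross_smul, cross_rot]
  have := dot_self_pos hu
  have := mul_self_pos.2 hσ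
  have : 0 < ε * (σ * σ) * dot u u := by positivity
  linarith

lemma neBot_sector {σ τ : ℝ} (hσ : σ ≠ 0) (hτ : τ ≠ 0) {u v : Plane} (h : cross u v ≠ 0)
    (x : Plane) : (𝓝[halfPlane σ u x ∩ halfPlane τ v x] x).NeBot := by
  -- With `c = cross u v`, this direction has cross product `σ * c ^ 2` with `u` and `τ * c ^ 2`
  -- with `v`.
  refine neBot_of_ray (w := (σ * cross u v) • v - (τ * cross u v) • u) fun ε hε => ?_
  simp only [halfPlane, mem_inter_iff, mem_ofPred_eq, add_sub_cancel_left]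
  rw [cross_smul, cross_smul, cross_sub, cross_sub, cross_smul, cross_smul, cross_smul, cross_smul,
    cross_self, cross_self, cross_swap v u]
  have h2 := mul_self_pos.2 h
  have h3 := mul_self_pos.2 hσ
  have h4 := mul_self_pos.2 hτ
  have h5 : 0 < ε * (σ * σ) * (cross u v * cross u v) := by positivity
  have h6 : 0 < ε * (τ * τ) * (cross u v * cross u v) := by positivity
  constructor <;> nlinarith

end Plane

/-! ### Segments in general position and their crossings. -/

/-- A family of line segments in general position: the endpoints of every segment are distinct and
do not lie on the other segments, and no point lies on three segments. -/
structure SegmentArrangement (ι : Type*) where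
  src : ι → Plane
  tgt : ι → Plane
  src_ne_tgt : ∀ i, src i ≠ tgt i
  src_mem : ∀ i j, src i ∈ segment ℝ (src j) (tgt j) → i = j
  tgt_mem : ∀ i j, tgt i ∈ segment ℝ (src j) (tgt j) → i = j
  no_triple : ∀ i j k p, p ∈ segment ℝ (src i) (tgt i) → p ∈ segment ℝ (src j) (tgt j) →
    p ∈ segment ℝ (src k) (tgt k) → i = j ∨ i = k ∨ j = k

namespace SegmentArrangement

open Plane

variable {ι : Type*} (S : SegmentArrangement ι)

def seg (i : ι) : Set Plane := segment ℝ (S.src i) (S.tgt i)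

def dir (i : ι) : Plane := S.tgt i - S.src i

/-- The point with parameter `t` on the line that carries the segment `i`. -/
def pt (i : ι) (t : ℝ) : Plane := S.src i + t • S.dir i

def union : Set Plane := ⋃ i, S.seg i

/-- The points that lie on two segments. -/
def crossings : Set Plane := {p | ∃ i j, i ≠ j ∧ p ∈ S.seg i ∧ p ∈ S.seg j}

lemma dir_ne_zero (i : ι) : S.dir i ≠ 0 := sub_ne_zero.2 (S.src_ne_tgt i).symm

@[simp] lemma pt_zero (i : ι) : S.pt i 0 = S.src i := by simp [pt]

@[simp] lemma pt_one (i : ι) : S.pt i 1 = S.tgt i := by simp [pt, dir]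

lemma continuous_pt (i : ι) : Continuous (S.pt i) := by unfold pt; fun_prop

lemma pt_injective (i : ι) : Function.Injective (S.pt i) := by
  intro s t h
  exact smul_left_injective ℝ (S.dir_ne_zero i) (add_left_cancel h)

lemma pt_sub_pt (i : ι) (s t : ℝ) : S.pt i s - S.pt i t = (s - t) • S.dir i := by
  simp only [pt, sub_smul]; abel

lemma pt_eq_add (i : ι) (s t : ℝ) : S.pt i s = S.pt i t + (s - t) • S.dir i := by
  rw [← pt_sub_pt]; abel

lemma seg_eq_image (i : ι) : S.seg i = S.pt i '' Icc 0 1 := segment_eq_image' ℝ _ _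

lemma pt_mem_seg {i : ι} {t : ℝ} : S.pt i t ∈ S.seg i ↔ t ∈ Icc (0 : ℝ) 1 := by
  rw [seg_eq_image, (S.pt_injective i).mem_set_image]

lemma segment_pt (i : ι) {a b : ℝ} (h : a ≤ b) :
    segment ℝ (S.pt i a) (S.pt i b) = S.pt i '' Icc a b := by
  have : S.pt i = AffineMap.lineMap (S.src i) (S.tgt i) := by
    ext1 t; simp [pt, dir, AffineMap.lineMap_apply, add_comm]
  rw [this, ← image_segment, segment_eq_Icc h]

lemma src_mem_seg (i : ι) : S.src i ∈ S.seg i := left_mem_segment ..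

lemma tgt_mem_seg (i : ι) : S.tgt i ∈ S.seg i := right_mem_segment ..

lemma isClosed_seg (i : ι) : IsClosed (S.seg i) := by
  rw [seg_eq_image]
  exact (isCompact_Icc.image (S.continuous_pt i)).isClosed

lemma isClosed_union [Finite ι] : IsClosed S.union := isClosed_iUnion_of_finite S.isClosed_seg

lemma mem_seg_iff {i : ι} {y : Plane} : y ∈ S.seg i ↔ cross (S.dir i) (y - S.src i) = 0 ∧
    0 ≤ dot (S.dir i) (y - S.src i) ∧
      dot (S.dir i) (y - S.src i) ≤ dot (S.dir i) (S.dir i) :=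
  mem_segment_iff (S.src_ne_tgt i)

/-- Two segments that meet are not parallel. -/
lemma cross_dir_ne_zero {i j : ι} (hij : i ≠ j) {p : Plane} (hi : p ∈ S.seg i)
    (hj : p ∈ S.seg j) : cross (S.dir i) (S.dir j) ≠ 0 := by
  intro h
  obtain ⟨k, hk⟩ : ∃ k : ℝ, S.dir j = k • S.dir i :=
    ⟨_, eq_smul_of_cross_eq_zero (S.dir_ne_zero i) h⟩
  have hk0 : k ≠ 0 := by
    rintro rfl
    exact S.dir_ne_zero j (by simpa using hk)
  rw [seg_eq_image] at hi hj
  obtain ⟨t, ⟨ht0, ht1⟩, rfl⟩ := hi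
  obtain ⟨s, ⟨hs0, hs1⟩, hst⟩ := hj
  -- Both segments lie on one line; this converts parameters of `j` into parameters of `i`.
  have key : ∀ r : ℝ, S.pt j r = S.pt i (t + (r - s) * k) := by
    intro r
    rw [S.pt_eq_add j r s, hst, S.pt_eq_add i (t + _) t, hk, smul_smul]
    congr 2
    ring
  have h0 : ¬ (t + (0 - s) * k ∈ Icc (0 : ℝ) 1) := by
    intro hm
    have := S.pt_mem_seg (i := i).2 hm
    rw [← key, pt_zero] at this
    exact hij (S.src_mem _ _ this).symm
  have h1 : ¬ (t + (1 - s) * k ∈ Icc (0 : ℝ) 1) := by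
    intro hm
    have := S.pt_mem_seg (i := i).2 hm
    rw [← key, pt_one] at this
    exact hij (S.tgt_mem _ _ this).symm
  have hsrc : ∀ r : ℝ, t + (r - s) * k = 0 → ¬ (r ∈ Icc (0 : ℝ) 1) := by
    intro r hr hm
    have := S.pt_mem_seg (i := j).2 hm
    rw [key, hr, pt_zero] at this
    exact hij (S.src_mem _ _ this)
  -- The ends of `j` miss `i` although `p` lies on it, so in the parameter of `i` they straddle `[0,
  -- 1]`. Then `j` contains the source of `i`, at the parameter chosen here.
  apply hsrc (s - t / k) (by field_simp; ring)
  simp only [mem_Icc, not_and_or, not_le] at h0 h1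
  rcases lt_or_gt_of_ne hk0 with hneg | hpos
  · have e1 : 1 < t + (0 - s) * k := by
      rcases h0 with h0 | h0
      · nlinarith
      · exact h0
    have e2 : t + (1 - s) * k < 0 := by
      rcases h1 with h1 | h1
      · exact h1
      · nlinarith
    have e3 : t / k ≤ 0 := div_nonpos_of_nonneg_of_nonpos ht0 hneg.le
    have e4 : s - 1 ≤ t / k := by
      rw [le_div_iff_of_neg hneg]; nlinarith
    constructor <;> linarith [show s - t / k ≤ 1 by linarith, show 0 ≤ s by linarith]
  · have e1 : t + (0 - s) * k < 0 := by
      rcases h0 with h0 | h0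
      · exact h0
      · nlinarith
    have e2 : 1 < t + (1 - s) * k := by
      rcases h1 with h1 | h1
      · nlinarith
      · exact h1
    have e3 : 0 ≤ t / k := by positivity
    have e4 : t / k ≤ s := by
      rw [div_le_iff₀ hpos]; nlinarith
    constructor <;> linarith

lemma eq_of_mem_seg {i j : ι} (hij : i ≠ j) {p q : Plane} (hpi : p ∈ S.seg i)
    (hpj : p ∈ S.seg j) (hqi : q ∈ S.seg i) (hqj : q ∈ S.seg j) : p = q := by
  have h := S.cross_dir_ne_zero hij hpi hpj
  rw [seg_eq_image] at hpi hpj hqi hqj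
  obtain ⟨t, -, rfl⟩ := hpi
  obtain ⟨t', -, rfl⟩ := hqi
  obtain ⟨s, -, hs⟩ := hpj
  obtain ⟨s', -, hs'⟩ := hqj
  have e : (t' - t) • S.dir i = (s' - s) • S.dir j := by
    rw [← pt_sub_pt, ← pt_sub_pt, hs, hs']
  have e2 : (s' - s) * cross (S.dir i) (S.dir j) = 0 := by
    rw [← cross_smul, ← e, cross_smul, cross_self, mul_zero]
  have : s' = s := by
    rcases mul_eq_zero.1 e2 with h' | h'
    · linarith
    · exact absurd h' h
  rw [← hs, ← hs', this]

lemma finite_crossings [Finite ι] : S.crossings.Finite := by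
  have : S.crossings ⊆ ⋃ ij : ι × ι, {p | ij.1 ≠ ij.2 ∧ p ∈ S.seg ij.1 ∧ p ∈ S.seg ij.2} := by
    rintro p ⟨i, j, h⟩
    exact mem_iUnion.2 ⟨(i, j), h⟩
  refine Finite.subset (finite_iUnion fun ij => Subsingleton.finite ?_) this
  rintro p ⟨h, hp1, hp2⟩ q ⟨-, hq1, hq2⟩
  exact S.eq_of_mem_seg h hp1 hp2 hq1 hq2

end SegmentArrangement

/-! ### Closures and their interiors, tested on the two sides of a line. -/

namespace Plane

/-- Nearby points off the line through `x` are in `F`, and those on the line are limits of points of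
`F` from one side. -/
lemma mem_interior_closure {F : Set Plane} {u x : Plane} (hu : u ≠ 0)
    (h1 : F ∈ 𝓝[halfPlane 1 u x] x) (h2 : F ∈ 𝓝[halfPlane (-1) u x] x) :
    x ∈ interior (closure F) := by
  rw [mem_interior_iff_mem_nhds]
  filter_upwards [eventually_eventually_nhds.2 (mem_nhdsWithin_iff_eventually.1 h1),
    eventually_eventually_nhds.2 (mem_nhdsWithin_iff_eventually.1 h2)] with y hy1 hy2
  rcases lt_trichotomy (cross u (y - x)) 0 with h | h | h
  · exact subset_closure (hy2.self_of_nhds (by simpa [halfPlane] using h))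
  · obtain ⟨c, hc⟩ : ∃ c : ℝ, y - x = c • u := ⟨_, eq_smul_of_cross_eq_zero hu h⟩
    have hyx : halfPlane 1 u y = halfPlane 1 u x := by
      rw [← halfPlane_add_smul 1 u x c, ← hc]; congr 1; abel
    have := neBot_halfPlane one_ne_zero hu y
    rw [hyx] at this
    have h3 : F ∈ 𝓝[halfPlane 1 u x] y := mem_nhdsWithin_iff_eventually.2 hy1
    exact mem_closure_of_frequently_of_tendsto (f := id) (b := 𝓝[halfPlane 1 u x] y)
      (Eventually.frequently h3) (tendsto_id'.2 nhdsWithin_le_nhds)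
  · exact subset_closure (hy1.self_of_nhds (by simpa [halfPlane] using h))

/-- Points of the open set `H` close to `x` have neighbourhoods disjoint from `F`, so arbitrarily
near `x` there are points outside `closure F`. -/
lemma notMem_interior_closure {F H : Set Plane} {x : Plane} (hH : IsOpen H) [(𝓝[H] x).NeBot]
    (h : Fᶜ ∈ 𝓝[H] x) : x ∉ interior (closure F) := by
  intro hx
  have hx := isOpen_interior.mem_nhds hx
  have h1 : ∀ᶠ y in 𝓝[H] x, ∀ᶠ z in 𝓝 y, z ∈ H → z ∈ Fᶜ :=
    nhdsWithin_le_nhds (eventually_eventually_nhds.2 (mem_nhdsWithin_iff_eventually.1 h))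
  have h2 : ∀ᶠ y in 𝓝[H] x, y ∈ interior (closure F) := nhdsWithin_le_nhds hx
  have h3 : ∀ᶠ y in 𝓝[H] x, y ∈ H := self_mem_nhdsWithin
  obtain ⟨y, hy1, hy2, hyH⟩ := (h1.and (h2.and h3)).exists
  have : Fᶜ ∈ 𝓝 y := by
    filter_upwards [hy1, hH.mem_nhds hyH] with z hz hz2 using hz hz2
  rw [← mem_interior_iff_mem_nhds, interior_compl] at this
  exact this (interior_subset hy2)

lemma mem_closure_of_mem_nhdsWithin {F H : Set Plane} {x : Plane} [(𝓝[H] x).NeBot]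
    (h : F ∈ 𝓝[H] x) : x ∈ closure F :=
  mem_closure_of_frequently_of_tendsto (f := id) (b := 𝓝[H] x)
      (Eventually.frequently h) (tendsto_id'.2 nhdsWithin_le_nhds)

lemma notMem_closure {F : Set Plane} (hF : IsOpen F) {u x : Plane} (hu : u ≠ 0)
    (h1 : Fᶜ ∈ 𝓝[halfPlane 1 u x] x) (h2 : Fᶜ ∈ 𝓝[halfPlane (-1) u x] x) :
    x ∉ closure F := by
  rw [← mem_compl_iff, ← interior_compl]
  have h := mem_interior_closure hu h1 h2
  rwa [hF.isClosed_compl.closure_eq] at h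

lemma not_both_mem {F H : Set Plane} {x : Plane} [(𝓝[H] x).NeBot]
    (h : F ∈ 𝓝[H] x) : ¬ Fᶜ ∈ 𝓝[H] x := by
  intro h2
  obtain ⟨y, hy, hy2⟩ := (Eventually.and h h2).exists
  exact hy2 hy

end Plane

/-! ### Faces near a segment: sides, sectors and ends. -/

namespace SegmentArrangement

open Plane

variable {ι : Type*} (S : SegmentArrangement ι)

/-- The faces are the connected components of the complement of the segments. -/
def IsFace (F : Set Plane) : Prop :=
  ∃ x ∈ S.unionᶜ, F = connectedComponentIn S.unionᶜ x

variable {S}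

lemma IsFace.isOpen [Finite ι] {F : Set Plane} (hF : S.IsFace F) : IsOpen F := by
  obtain ⟨x, -, rfl⟩ := hF
  exact S.isClosed_union.isOpen_compl.connectedComponentIn

lemma IsFace.subset {F : Set Plane} (hF : S.IsFace F) : F ⊆ S.unionᶜ := by
  obtain ⟨x, -, rfl⟩ := hF
  exact connectedComponentIn_subset _ _

lemma IsFace.isPreconnected {F : Set Plane} (hF : S.IsFace F) : IsPreconnected F := by
  obtain ⟨x, -, rfl⟩ := hF
  exact isPreconnected_connectedComponentIn

/-- A small ball intersected with `H` is convex and avoids the segments, so it lies in one connected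
component of the complement. -/
lemma IsFace.dichotomy {F : Set Plane} (hF : S.IsFace F) {H : Set Plane}
    (hH : Convex ℝ H) {x : Plane} (h : ∀ᶠ y in 𝓝[H] x, y ∉ S.union) :
    F ∈ 𝓝[H] x ∨ Fᶜ ∈ 𝓝[H] x := by
  obtain ⟨r, hr, hsub⟩ := Metric.mem_nhdsWithin_iff.1 h
  have hpre : IsPreconnected (Metric.ball x r ∩ H) := ((convex_ball x r).inter hH).isPreconnected
  by_cases hne : ((Metric.ball x r ∩ H) ∩ F).Nonempty
  · left
    obtain ⟨y, hy, hyF⟩ := hne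
    refine Metric.mem_nhdsWithin_iff.2 ⟨r, hr, ?_⟩
    obtain ⟨z, hz, rfl⟩ := hF
    rw [connectedComponentIn_eq hyF]
    exact hpre.subset_connectedComponentIn hy hsub
  · right
    exact Metric.mem_nhdsWithin_iff.2 ⟨r, hr, fun y hy hyF => hne ⟨y, hy, hyF⟩⟩

lemma IsFace.transfer {F : Set Plane} (hF : S.IsFace F) {H H' : Set Plane}
    (hH : Convex ℝ H') {x : Plane} (h : ∀ᶠ y in 𝓝[H'] x, y ∉ S.union)
    [hne : (𝓝[H ∩ H'] x).NeBot] (hFH : F ∈ 𝓝[H] x) : F ∈ 𝓝[H'] x := by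
  refine (hF.dichotomy hH h).resolve_right fun h2 => ?_
  exact not_both_mem (nhdsWithin_mono x inter_subset_left hFH)
    (nhdsWithin_mono x inter_subset_right h2)

variable (S)

lemma eventually_notMem_union [Finite ι] {H : Set Plane} {x : Plane}
    (h : ∀ j, x ∉ S.seg j ∨ ∀ y ∈ H, y ∉ S.seg j) : ∀ᶠ y in 𝓝[H] x, y ∉ S.union := by
  have : ∀ᶠ y in 𝓝[H] x, ∀ j, y ∉ S.seg j := by
    rw [eventually_all]
    intro j
    rcases h j with h | h
    · exact nhdsWithin_le_nhds ((S.isClosed_seg j).isOpen_compl.mem_nhds h)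
    · filter_upwards [self_mem_nhdsWithin] with y hy using h y hy
  filter_upwards [this] with y hy
  simpa [union] using hy

lemma notMem_seg_of_mem_halfPlane {i : ι} {σ : ℝ} {x y : Plane} (hx : x ∈ S.seg i)
    (hy : y ∈ halfPlane σ (S.dir i) x) : y ∉ S.seg i := by
  intro h
  have h1 := (S.mem_seg_iff.1 h).1
  have h2 := (S.mem_seg_iff.1 hx).1
  have : cross (S.dir i) (y - x) = 0 := by
    simp only [cross, PiLp.sub_apply] at *
    linarith
  simp [halfPlane, this] at hy

lemma halfPlane_pt (σ : ℝ) (i : ι) (s t : ℝ) :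
    halfPlane σ (S.dir i) (S.pt i s) = halfPlane σ (S.dir i) (S.pt i t) := by
  rw [S.pt_eq_add i s t, halfPlane_add_smul]

/-- Near the point with parameter `t` of the segment `i`, the set `A` contains the side of the
segment that is given by the sign of `σ`. -/
def Side (A : Set Plane) (i : ι) (σ t : ℝ) : Prop :=
  A ∈ 𝓝[halfPlane σ (S.dir i) (S.pt i t)] (S.pt i t)

/-- Moving along the segment does not change its half planes, so a condition near one point passes
to nearby points. The open set `K` serves at a crossing, where only one direction along `i` may be
used. -/
lemma eventually_side {A K : Set Plane} (hK : IsOpen K) {i : ι} {σ t : ℝ}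
    (h : A ∈ 𝓝[halfPlane σ (S.dir i) (S.pt i t) ∩ K] (S.pt i t)) :
    ∀ᶠ s in 𝓝 t, S.pt i s ∈ K → S.Side A i σ s := by
  have h1 := eventually_eventually_nhds.2 (mem_nhdsWithin_iff_eventually.1 h)
  filter_upwards [(S.continuous_pt i).tendsto t h1] with s hs hsK
  rw [Side, mem_nhdsWithin_iff_eventually, S.halfPlane_pt σ i s t]
  filter_upwards [hs, hK.mem_nhds hsK] with y hy hyK hyH using hy ⟨hyH, hyK⟩

lemma isOpen_setOf_side (A : Set Plane) (i : ι) (σ : ℝ) : IsOpen {t | S.Side A i σ t} := by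
  rw [isOpen_iff_mem_nhds]
  intro t ht
  filter_upwards [S.eventually_side (K := univ) isOpen_univ
    (by rw [inter_univ]; exact ht)] with s hs using hs (mem_univ _)

lemma not_side_compl {A : Set Plane} {i : ι} {σ t : ℝ} (hσ : σ ≠ 0) (h : S.Side A i σ t) :
    ¬ S.Side Aᶜ i σ t :=
  have := neBot_halfPlane hσ (S.dir_ne_zero i) (S.pt i t)
  not_both_mem h

/-- The parameters of the points of the segment `i` that are not on other segments and are not
endpoints. -/
def Regular (i : ι) (t : ℝ) : Prop := t ∈ Ioo (0 : ℝ) 1 ∧ ∀ j ≠ i, S.pt i t ∉ S.seg j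

variable {S}

lemma Regular.off [Finite ι] {i : ι} {t : ℝ} (h : S.Regular i t) (σ : ℝ) :
    ∀ᶠ y in 𝓝[halfPlane σ (S.dir i) (S.pt i t)] (S.pt i t), y ∉ S.union := by
  refine S.eventually_notMem_union fun j => ?_
  by_cases hj : j = i
  · subst hj
    exact Or.inr fun y hy => S.notMem_seg_of_mem_halfPlane
      (S.pt_mem_seg.2 (Ioo_subset_Icc_self h.1)) hy
  · exact Or.inl (h.2 j hj)

lemma Regular.side_or [Finite ι] {i : ι} {t : ℝ} (h : S.Regular i t) (σ : ℝ) {F : Set Plane}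
    (hF : S.IsFace F) : S.Side F i σ t ∨ S.Side Fᶜ i σ t :=
  hF.dichotomy (convex_halfPlane _ _ _) (h.off σ)

/-- The parameters whose side lies in `F` and those whose side lies in the complement are disjoint
open sets covering the connected interval. -/
lemma IsFace.side_const [Finite ι] {F : Set Plane} (hF : S.IsFace F) {i : ι} {σ a b : ℝ}
    (hσ : σ ≠ 0) (h : ∀ t ∈ Ioo a b, S.Regular i t) {s t : ℝ} (hs : s ∈ Ioo a b)
    (ht : t ∈ Ioo a b) (hside : S.Side F i σ s) : S.Side F i σ t := by
  refine IsPreconnected.subset_left_of_subset_union (S.isOpen_setOf_side F i σ)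
    (S.isOpen_setOf_side Fᶜ i σ) ?_ (fun r hr => (h r hr).side_or σ hF) ⟨s, hs, hside⟩
    isPreconnected_Ioo ht
  rw [disjoint_left]
  exact fun r hr => S.not_side_compl hσ hr

/-- The side of the segment `i` along an interval without nodes, seen from its lower end. -/
lemma IsFace.eventually_side_right [Finite ι] {F : Set Plane} (hF : S.IsFace F) {i : ι}
    {σ a b : ℝ} (hσ : σ ≠ 0) (h : ∀ t ∈ Ioo a b, S.Regular i t) {t : ℝ} (ht : t ∈ Ioo a b) :
    (∀ᶠ s in 𝓝[>] a, S.Side F i σ s) ↔ S.Side F i σ t := by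
  have hab : Ioo a b ∈ 𝓝[>] a := Ioo_mem_nhdsGT (ht.1.trans ht.2)
  constructor
  · intro h2
    obtain ⟨s, hs, hs2⟩ := (h2.and hab).exists
    exact hF.side_const hσ h hs2 ht hs
  · intro h2
    filter_upwards [hab] with s hs using hF.side_const hσ h ht hs h2

lemma IsFace.eventually_side_left [Finite ι] {F : Set Plane} (hF : S.IsFace F) {i : ι}
    {σ a b : ℝ} (hσ : σ ≠ 0) (h : ∀ t ∈ Ioo a b, S.Regular i t) {t : ℝ} (ht : t ∈ Ioo a b) :
    (∀ᶠ s in 𝓝[<] b, S.Side F i σ s) ↔ S.Side F i σ t := by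
  have hab : Ioo a b ∈ 𝓝[<] b := Ioo_mem_nhdsLT (ht.1.trans ht.2)
  constructor
  · intro h2
    obtain ⟨s, hs, hs2⟩ := (h2.and hab).exists
    exact hF.side_const hσ h hs2 ht hs
  · intro h2
    filter_upwards [hab] with s hs using hF.side_const hσ h ht hs h2

lemma IsFace.eventually_side_iff {F : Set Plane} (hF : S.IsFace F) {i : ι}
    {σ t : ℝ} (hσ : σ ≠ 0) {K : Set Plane} (hK : IsOpen K) (hKc : Convex ℝ K) {l : Filter ℝ}
    [l.NeBot] (hl : l ≤ 𝓝 t) (hlK : ∀ᶠ s in l, S.pt i s ∈ K)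
    (hoff : ∀ᶠ y in 𝓝[halfPlane σ (S.dir i) (S.pt i t) ∩ K] (S.pt i t), y ∉ S.union) :
    (∀ᶠ s in l, S.Side F i σ s) ↔
      F ∈ 𝓝[halfPlane σ (S.dir i) (S.pt i t) ∩ K] (S.pt i t) := by
  have key : ∀ A : Set Plane, A ∈ 𝓝[halfPlane σ (S.dir i) (S.pt i t) ∩ K] (S.pt i t) →
      ∀ᶠ s in l, S.Side A i σ s := by
    intro A hA
    filter_upwards [hl (S.eventually_side hK hA), hlK] with s hs hs2 using hs hs2
  refine ⟨fun h => ?_, key F⟩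
  refine (hF.dichotomy ((convex_halfPlane _ _ _).inter hKc) hoff).resolve_right fun h2 => ?_
  obtain ⟨s, hs, hs2⟩ := (h.and (key _ h2)).exists
  exact S.not_side_compl hσ hs hs2

variable (S)

/-- The sector at `p` between the segments `i` and `j`, on the sides given by the signs. -/
def sector (i j : ι) (σ τ : ℝ) (p : Plane) : Set Plane :=
  halfPlane σ (S.dir i) p ∩ halfPlane τ (S.dir j) p

lemma sector_swap (i j : ι) (σ τ : ℝ) (p : Plane) : S.sector i j σ τ p = S.sector j i τ σ p :=
  inter_comm _ _

lemma convex_sector (i j : ι) (σ τ : ℝ) (p : Plane) : Convex ℝ (S.sector i j σ τ p) :=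
  (convex_halfPlane _ _ _).inter (convex_halfPlane _ _ _)

lemma neBot_sector {i j : ι} (hij : i ≠ j) {p : Plane} (hi : p ∈ S.seg i) (hj : p ∈ S.seg j)
    {σ τ : ℝ} (hσ : σ ≠ 0) (hτ : τ ≠ 0) : (𝓝[S.sector i j σ τ p] p).NeBot :=
  Plane.neBot_sector hσ hτ (S.cross_dir_ne_zero hij hi hj) p

lemma sector_off [Finite ι] {i j : ι} (hij : i ≠ j) {p : Plane} (hi : p ∈ S.seg i)
    (hj : p ∈ S.seg j) (σ τ : ℝ) : ∀ᶠ y in 𝓝[S.sector i j σ τ p] p, y ∉ S.union := by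
  refine S.eventually_notMem_union fun k => ?_
  by_cases hk : p ∈ S.seg k
  · right
    rcases S.no_triple i j k p hi hj hk with h | h | h
    · exact absurd h hij
    · subst h
      exact fun y hy => S.notMem_seg_of_mem_halfPlane hi hy.1
    · subst h
      exact fun y hy => S.notMem_seg_of_mem_halfPlane hj hy.2
  · exact Or.inl hk

variable {S}

/-- The condition on `τ` says that, for parameters beyond `t`, segment `i` runs in the half plane of
`j` with sign `τ`; the sector is what its `σ` side sees there. -/
lemma IsFace.side_right_iff_sector [Finite ι] {F : Set Plane} (hF : S.IsFace F) {i j : ι}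
    (hij : i ≠ j) {σ τ t : ℝ} (hσ : σ ≠ 0) (ht : S.pt i t ∈ S.seg i) (htj : S.pt i t ∈ S.seg j)
    (hτ : 0 < τ * cross (S.dir j) (S.dir i)) :
    (∀ᶠ s in 𝓝[>] t, S.Side F i σ s) ↔ F ∈ 𝓝[S.sector i j σ τ (S.pt i t)] (S.pt i t) := by
  refine hF.eventually_side_iff hσ (isOpen_halfPlane _ _ _) (convex_halfPlane _ _ _)
    nhdsWithin_le_nhds ?_ (S.sector_off hij ht htj σ τ)
  filter_upwards [self_mem_nhdsWithin] with s hs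
  simp only [halfPlane, mem_ofPred_eq, pt_sub_pt, cross_smul]
  have : 0 < s - t := sub_pos.2 hs
  nlinarith [mul_pos this hτ]

lemma IsFace.side_left_iff_sector [Finite ι] {F : Set Plane} (hF : S.IsFace F) {i j : ι}
    (hij : i ≠ j) {σ τ t : ℝ} (hσ : σ ≠ 0) (ht : S.pt i t ∈ S.seg i) (htj : S.pt i t ∈ S.seg j)
    (hτ : τ * cross (S.dir j) (S.dir i) < 0) :
    (∀ᶠ s in 𝓝[<] t, S.Side F i σ s) ↔ F ∈ 𝓝[S.sector i j σ τ (S.pt i t)] (S.pt i t) := by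
  refine hF.eventually_side_iff hσ (isOpen_halfPlane _ _ _) (convex_halfPlane _ _ _)
    nhdsWithin_le_nhds ?_ (S.sector_off hij ht htj σ τ)
  filter_upwards [self_mem_nhdsWithin] with s hs
  simp only [halfPlane, mem_ofPred_eq, pt_sub_pt, cross_smul]
  have : s - t < 0 := sub_neg.2 hs
  nlinarith [mul_pos_of_neg_of_neg this hτ]

lemma convex_setOf_dot_pos (c : ℝ) (u x : Plane) : Convex ℝ {y | 0 < c * dot u (y - x)} := by
  have : {y | 0 < c * dot u (y - x)} = halfPlane c (-rot u) x := by
    ext y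
    simp [halfPlane, cross, dot, rot]
    ring_nf
  rw [this]
  exact convex_halfPlane _ _ _

/-- At an end of a segment, the two sides belong to the same face. -/
lemma IsFace.mem_nhdsWithin_iff_of_end [Finite ι] {F : Set Plane} (hF : S.IsFace F) {i : ι}
    {v : Plane} (hv : v ∈ S.seg i) (hother : ∀ j ≠ i, v ∉ S.seg j) {c : ℝ} (hc : c ≠ 0)
    (hend : ∀ y ∈ S.seg i, c * dot (S.dir i) (y - v) ≤ 0) {σ : ℝ} (hσ : σ = 1 ∨ σ = -1) :
    F ∈ 𝓝[halfPlane σ (S.dir i) v] v ↔ v ∈ interior (closure F) := by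
  have hoff : ∀ σ, ∀ᶠ y in 𝓝[halfPlane σ (S.dir i) v] v, y ∉ S.union := by
    refine fun σ => S.eventually_notMem_union fun j => ?_
    by_cases hj : j = i
    · subst hj
      exact Or.inr fun y hy => S.notMem_seg_of_mem_halfPlane hv hy
    · exact Or.inl (hother j hj)
  -- The half plane beyond the end is free of segments near `v` and overlaps both sides, so it joins
  -- them.
  have hoff' : ∀ᶠ y in 𝓝[{y | 0 < c * dot (S.dir i) (y - v)}] v, y ∉ S.union := by
    refine S.eventually_notMem_union fun j => ?_
    by_cases hj : j = i
    · subst hj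
      exact Or.inr fun y hy hy2 => absurd (hend y hy2) (not_le.2 hy)
    · exact Or.inl (hother j hj)
  have hd := dot_self_pos (S.dir_ne_zero i)
  have hne : ∀ σ : ℝ, σ ≠ 0 →
      (𝓝[halfPlane σ (S.dir i) v ∩ {y | 0 < c * dot (S.dir i) (y - v)}] v).NeBot := by
    intro σ hσ
    refine neBot_of_ray (w := σ • rot (S.dir i) + c • S.dir i) fun ε hε => ?_
    simp only [halfPlane, mem_inter_iff, mem_ofPred_eq, add_sub_cancel_left]
    rw [cross_smul, dot_smul, cross_add, dot_add, cross_smul, cross_smul, dot_smul, dot_smul,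
      cross_rot, cross_self]
    have h0 : dot (S.dir i) (rot (S.dir i)) = 0 := by simp [dot, rot]; ring
    rw [h0]
    have h1 := mul_self_pos.2 hσ
    have h2 := mul_self_pos.2 hc
    have h3 : 0 < ε * (σ * σ) * dot (S.dir i) (S.dir i) := by positivity
    have h4 : 0 < ε * (c * c) * dot (S.dir i) (S.dir i) := by positivity
    constructor <;> nlinarith
  have hstep : ∀ σ σ' : ℝ, σ ≠ 0 → σ' ≠ 0 → F ∈ 𝓝[halfPlane σ (S.dir i) v] v →
      F ∈ 𝓝[halfPlane σ' (S.dir i) v] v := by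
    intro σ σ' h h' hFσ
    have i1 := hne σ h
    have i2 := hne σ' h'
    rw [inter_comm] at i2
    exact hF.transfer (convex_halfPlane _ _ _) (hoff σ')
      (hF.transfer (convex_setOf_dot_pos _ _ _) hoff' hFσ)
  have hσ0 : σ ≠ 0 := by rcases hσ with rfl | rfl <;> norm_num
  constructor
  · intro h
    exact mem_interior_closure (S.dir_ne_zero i) (hstep σ _ hσ0 one_ne_zero h)
      (hstep σ _ hσ0 (by norm_num) h)
  · intro h
    refine (hF.dichotomy (convex_halfPlane _ _ _) (hoff σ)).resolve_right fun h2 => ?_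
    have := neBot_halfPlane hσ0 (S.dir_ne_zero i) v
    exact notMem_interior_closure (isOpen_halfPlane _ _ _) h2 h

lemma IsFace.side_right_iff_src [Finite ι] {F : Set Plane} (hF : S.IsFace F) (i : ι)
    {σ : ℝ} (hσ : σ = 1 ∨ σ = -1) :
    (∀ᶠ s in 𝓝[>] 0, S.Side F i σ s) ↔ S.src i ∈ interior (closure F) := by
  have hσ0 : σ ≠ 0 := by rcases hσ with rfl | rfl <;> norm_num
  have hother : ∀ j ≠ i, S.src i ∉ S.seg j := fun j hj h => hj (S.src_mem i j h).symm
  rw [← hF.mem_nhdsWithin_iff_of_end (S.src_mem_seg i) hother (c := -1) (by norm_num) ?_ hσ]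
  · have := hF.eventually_side_iff (i := i) (t := 0) (l := 𝓝[>] 0) (K := univ) hσ0 isOpen_univ
      convex_univ nhdsWithin_le_nhds (by simp) ?_
    · simpa using this
    · refine S.eventually_notMem_union fun j => ?_
      by_cases hj : j = i
      · subst hj
        exact Or.inr fun y hy => S.notMem_seg_of_mem_halfPlane
          (by simpa using S.src_mem_seg j) hy.1
      · exact Or.inl (by simpa using hother j hj)
  · intro y hy
    have := (S.mem_seg_iff.1 hy).2.1
    linarith

lemma IsFace.side_left_iff_tgt [Finite ι] {F : Set Plane} (hF : S.IsFace F) (i : ι)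
    {σ : ℝ} (hσ : σ = 1 ∨ σ = -1) :
    (∀ᶠ s in 𝓝[<] 1, S.Side F i σ s) ↔ S.tgt i ∈ interior (closure F) := by
  have hσ0 : σ ≠ 0 := by rcases hσ with rfl | rfl <;> norm_num
  have hother : ∀ j ≠ i, S.tgt i ∉ S.seg j := fun j hj h => hj (S.tgt_mem i j h).symm
  rw [← hF.mem_nhdsWithin_iff_of_end (S.tgt_mem_seg i) hother (c := 1) (by norm_num) ?_ hσ]
  · have := hF.eventually_side_iff (i := i) (t := 1) (l := 𝓝[<] 1) (K := univ) hσ0 isOpen_univ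
      convex_univ nhdsWithin_le_nhds (by simp) ?_
    · simpa using this
    · refine S.eventually_notMem_union fun j => ?_
      by_cases hj : j = i
      · subst hj
        exact Or.inr fun y hy => S.notMem_seg_of_mem_halfPlane
          (by simpa using S.tgt_mem_seg j) hy.1
      · exact Or.inl (by simpa using hother j hj)
  · intro y hy
    have := (S.mem_seg_iff.1 hy).2.2
    have e : y - S.src i = (y - S.tgt i) + S.dir i := by simp [dir]
    rw [e, dot_add] at this
    linarith

/-- With `F` on both sides the point is interior to the closure; with `F` on neither side it is
outside the closure. -/
lemma IsFace.pt_mem_frontier_iff [Finite ι] {F : Set Plane} (hF : S.IsFace F) {i : ι} {t : ℝ}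
    (ht : S.Regular i t) :
    S.pt i t ∈ frontier (closure F) ↔ ¬ (S.Side F i 1 t ↔ S.Side F i (-1) t) := by
  have n1 := neBot_halfPlane one_ne_zero (S.dir_ne_zero i) (S.pt i t)
  have n2 := neBot_halfPlane (neg_ne_zero.2 (one_ne_zero (α := ℝ))) (S.dir_ne_zero i) (S.pt i t)
  rw [frontier, closure_closure, Set.mem_sdiff]
  rcases ht.side_or 1 hF with h1 | h1 <;> rcases ht.side_or (-1) hF with h2 | h2
  · simp only [h1, h2, not_true, iff_false, not_and, not_not]
    exact fun _ => mem_interior_closure (S.dir_ne_zero i) h1 h2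
  · have h3 : ¬ S.Side F i (-1) t := fun h => not_both_mem h h2
    simp only [h1, h3, iff_false, not_true, not_false_iff, iff_true]
    exact ⟨mem_closure_of_mem_nhdsWithin h1, notMem_interior_closure (isOpen_halfPlane _ _ _) h2⟩
  · have h3 : ¬ S.Side F i 1 t := fun h => not_both_mem h h1
    simp only [h2, h3, iff_true, not_false_iff]
    exact ⟨mem_closure_of_mem_nhdsWithin h2, notMem_interior_closure (isOpen_halfPlane _ _ _) h1⟩
  · have h3 : ¬ S.Side F i 1 t := fun h => not_both_mem h h1
    have h4 : ¬ S.Side F i (-1) t := fun h => not_both_mem h h2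
    simp only [h3, h4, not_true, iff_false, not_and]
    exact fun h => absurd h (notMem_closure hF.isOpen (S.dir_ne_zero i) h1 h2)

lemma IsFace.segment_subset_frontier_iff [Finite ι] {F : Set Plane} (hF : S.IsFace F) {i : ι}
    {a b t : ℝ} (h : ∀ t ∈ Ioo a b, S.Regular i t) (ht : t ∈ Ioo a b) :
    segment ℝ (S.pt i a) (S.pt i b) ⊆ frontier (closure F) ↔
      ¬ (S.Side F i 1 t ↔ S.Side F i (-1) t) := by
  have hab := ht.1.trans ht.2
  rw [S.segment_pt i hab.le]
  constructor
  · intro h2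
    rw [← hF.pt_mem_frontier_iff (h t ht)]
    exact h2 (mem_image_of_mem _ (Ioo_subset_Icc_self ht))
  · intro h2
    have h3 : S.pt i '' Ioo a b ⊆ frontier (closure F) := by
      rintro _ ⟨s, hs, rfl⟩
      rw [hF.pt_mem_frontier_iff (h s hs)]
      have e1 : S.Side F i 1 s ↔ S.Side F i 1 t :=
        ⟨hF.side_const one_ne_zero h hs ht, hF.side_const one_ne_zero h ht hs⟩
      have e2 : S.Side F i (-1) s ↔ S.Side F i (-1) t :=
        ⟨hF.side_const (by norm_num) h hs ht, hF.side_const (by norm_num) h ht hs⟩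
      rwa [e1, e2]
    -- The end nodes are not regular points; they are reached because the frontier is closed.
    rw [← closure_Ioo hab.ne]
    exact (image_closure_subset_closure_image (S.continuous_pt i)).trans
      (closure_minimal h3 isClosed_frontier)

end SegmentArrangement

/-! ### Sums over consecutive pairs and over signs. -/

/-- The pairs of consecutive elements of a finite set of real numbers. -/
noncomputable def consecutivePairs (P : Finset ℝ) : Finset (ℝ × ℝ) :=
  {ab ∈ P ×ˢ P | ab.1 < ab.2 ∧ ∀ c ∈ P, ¬ (ab.1 < c ∧ c < ab.2)}

lemma mem_consecutivePairs {P : Finset ℝ} {ab : ℝ × ℝ} : ab ∈ consecutivePairs P ↔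
    (ab.1 ∈ P ∧ ab.2 ∈ P) ∧ ab.1 < ab.2 ∧ ∀ c ∈ P, ¬ (ab.1 < c ∧ c < ab.2) := by
  simp [consecutivePairs]

/-- Every element except the maximum has exactly one successor. -/
lemma sum_consecutivePairs_fst {P : Finset ℝ} {M : ℝ} (hM : M ∈ P) (hmax : ∀ x ∈ P, x ≤ M)
    (α : ℝ → ℕ) : ∑ ab ∈ consecutivePairs P, α ab.1 = ∑ t ∈ P.erase M, α t := by
  refine Finset.sum_bij (fun ab _ => ab.1) ?_ ?_ ?_ (fun _ _ => rfl)
  · intro ab hab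
    rw [mem_consecutivePairs] at hab
    exact Finset.mem_erase.2 ⟨(hab.2.1.trans_le (hmax _ hab.1.2)).ne, hab.1.1⟩
  · rintro ⟨a, b⟩ h ⟨a', b'⟩ h' rfl
    rw [mem_consecutivePairs] at h h'
    have h1 := h.2.2 b' h'.1.2
    have h2 := h'.2.2 b h.1.2
    simp only [not_and, not_lt] at h1 h2
    exact Prod.ext rfl (le_antisymm (h1 h'.2.1) (h2 h.2.1))
  · intro t ht
    rw [Finset.mem_erase] at ht
    have hne : ({x ∈ P | t < x} : Finset ℝ).Nonempty :=
      ⟨M, Finset.mem_filter.2 ⟨hM, lt_of_le_of_ne (hmax t ht.2) ht.1⟩⟩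
    have hmem := Finset.mem_filter.1 (Finset.min'_mem _ hne)
    refine ⟨(t, Finset.min' _ hne), mem_consecutivePairs.2 ⟨⟨ht.2, hmem.1⟩, hmem.2, ?_⟩, rfl⟩
    rintro c hc ⟨h1, h2⟩
    exact absurd (Finset.min'_le _ c (Finset.mem_filter.2 ⟨hc, h1⟩)) (not_le.2 h2)

lemma sum_consecutivePairs_snd {P : Finset ℝ} {m : ℝ} (hm : m ∈ P) (hmin : ∀ x ∈ P, m ≤ x)
    (α : ℝ → ℕ) : ∑ ab ∈ consecutivePairs P, α ab.2 = ∑ t ∈ P.erase m, α t := by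
  refine Finset.sum_bij (fun ab _ => ab.2) ?_ ?_ ?_ (fun _ _ => rfl)
  · intro ab hab
    rw [mem_consecutivePairs] at hab
    exact Finset.mem_erase.2 ⟨((hmin _ hab.1.1).trans_lt hab.2.1).ne', hab.1.2⟩
  · rintro ⟨a, b⟩ h ⟨a', b'⟩ h' rfl
    rw [mem_consecutivePairs] at h h'
    have h1 := h.2.2 a' h'.1.1
    have h2 := h'.2.2 a h.1.1
    simp only [not_and', not_lt] at h1 h2
    exact Prod.ext (le_antisymm (h2 h.2.1) (h1 h'.2.1)) rfl
  · intro t ht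
    rw [Finset.mem_erase] at ht
    have hne : ({x ∈ P | x < t} : Finset ℝ).Nonempty :=
      ⟨m, Finset.mem_filter.2 ⟨hm, lt_of_le_of_ne (hmin t ht.2) ht.1.symm⟩⟩
    have hmem := Finset.mem_filter.1 (Finset.max'_mem _ hne)
    refine ⟨(Finset.max' _ hne, t), mem_consecutivePairs.2 ⟨⟨hmem.1, ht.2⟩, hmem.2, ?_⟩, rfl⟩
    rintro c hc ⟨h1, h2⟩
    exact absurd (Finset.le_max' _ c (Finset.mem_filter.2 ⟨hc, h2⟩)) (not_le.2 h1)

/-- The two signs, as real numbers. -/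
noncomputable def signs : Finset ℝ := {1, -1}

lemma mem_signs {σ : ℝ} : σ ∈ signs ↔ σ = 1 ∨ σ = -1 := by simp [signs]

lemma ne_zero_of_mem_signs {σ : ℝ} (h : σ ∈ signs) : σ ≠ 0 := by
  rcases mem_signs.1 h with rfl | rfl <;> norm_num

lemma sum_signs {M : Type*} [AddCommMonoid M] (f : ℝ → M) : ∑ σ ∈ signs, f σ = f 1 + f (-1) :=
  Finset.sum_pair (by norm_num)

lemma sum_mod_two_congr {α : Type*} {s : Finset α} {f g : α → ℕ}
    (h : ∀ x ∈ s, f x % 2 = g x % 2) : (∑ x ∈ s, f x) % 2 = (∑ x ∈ s, g x) % 2 := by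
  rw [Finset.sum_nat_mod, Finset.sum_congr rfl h, ← Finset.sum_nat_mod]

/-! ### Double counting of sides, corners and ends. -/

namespace SegmentArrangement

open Plane

variable {ι : Type*} (S : SegmentArrangement ι)

lemma finite_crossParams [Finite ι] (i : ι) :
    {t : ℝ | t ∈ Icc (0 : ℝ) 1 ∧ ∃ j ≠ i, S.pt i t ∈ S.seg j}.Finite := by
  refine Finite.of_finite_image (f := S.pt i) (S.finite_crossings.subset ?_)
    (S.pt_injective i).injOn
  rintro _ ⟨t, ⟨ht, j, hj, htj⟩, rfl⟩
  exact ⟨i, j, hj.symm, S.pt_mem_seg.2 ht, htj⟩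

/-- The parameters of the crossings on the segment `i`. -/
noncomputable def crossParams [Finite ι] (i : ι) : Finset ℝ := (S.finite_crossParams i).toFinset

/-- The parameters of the nodes on the segment `i`. -/
noncomputable def params [Finite ι] (i : ι) : Finset ℝ := insert 0 (insert 1 (S.crossParams i))

noncomputable def crossFinset [Finite ι] : Finset Plane := S.finite_crossings.toFinset

lemma mem_crossFinset [Finite ι] {p : Plane} :
    p ∈ S.crossFinset ↔ ∃ i j, i ≠ j ∧ p ∈ S.seg i ∧ p ∈ S.seg j := by
  simp [crossFinset, crossings]

lemma mem_crossParams [Finite ι] {i : ι} {t : ℝ} :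
    t ∈ S.crossParams i ↔ t ∈ Icc (0 : ℝ) 1 ∧ ∃ j ≠ i, S.pt i t ∈ S.seg j := by
  simp [crossParams]

lemma crossParams_subset_Ioo [Finite ι] {i : ι} {t : ℝ} (ht : t ∈ S.crossParams i) :
    t ∈ Ioo (0 : ℝ) 1 := by
  obtain ⟨⟨h0, h1⟩, j, hj, htj⟩ := S.mem_crossParams.1 ht
  refine ⟨lt_of_le_of_ne h0 ?_, lt_of_le_of_ne h1 ?_⟩
  · rintro rfl
    rw [pt_zero] at htj
    exact hj (S.src_mem i j htj).symm
  · rintro rfl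
    rw [pt_one] at htj
    exact hj (S.tgt_mem i j htj).symm

lemma params_subset_Icc [Finite ι] {i : ι} {t : ℝ} (ht : t ∈ S.params i) :
    t ∈ Icc (0 : ℝ) 1 := by
  simp only [params, Finset.mem_insert] at ht
  rcases ht with rfl | rfl | ht
  · simp
  · simp
  · exact Ioo_subset_Icc_self (S.crossParams_subset_Ioo ht)

lemma regular_of_notMem_params [Finite ι] {i : ι} {t : ℝ} (ht : t ∈ Icc (0 : ℝ) 1)
    (h : t ∉ S.params i) : S.Regular i t := by
  simp only [params, Finset.mem_insert, not_or, mem_crossParams, not_and, not_exists] at h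
  exact ⟨⟨lt_of_le_of_ne ht.1 (Ne.symm h.1), lt_of_le_of_ne ht.2 h.2.1⟩, h.2.2 ht⟩

lemma regular_of_consecutivePairs [Finite ι] {i : ι} {ab : ℝ × ℝ}
    (h : ab ∈ consecutivePairs (S.params i)) : ∀ t ∈ Ioo ab.1 ab.2, S.Regular i t := by
  intro t ht
  rw [mem_consecutivePairs] at h
  refine S.regular_of_notMem_params ⟨?_, ?_⟩ fun htm => h.2.2 t htm ht
  · exact (S.params_subset_Icc h.1.1).1.trans ht.1.le
  · exact ht.2.le.trans (S.params_subset_Icc h.1.2).2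

lemma erase_zero_params [Finite ι] (i : ι) :
    (S.params i).erase 0 = insert 1 (S.crossParams i) := by
  refine Finset.erase_insert fun h => ?_
  rcases Finset.mem_insert.1 h with h | h
  · norm_num at h
  · exact lt_irrefl _ (S.crossParams_subset_Ioo h).1

lemma erase_one_params [Finite ι] (i : ι) :
    (S.params i).erase 1 = insert 0 (S.crossParams i) := by
  rw [params, Finset.insert_comm]
  refine Finset.erase_insert fun h => ?_
  rcases Finset.mem_insert.1 h with h | h
  · norm_num at h
  · exact lt_irrefl _ (S.crossParams_subset_Ioo h).2

/-- Exactly two segments pass through a crossing. The weights used are constantly 1, with `c = 2`,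
and the 0/1 values of a proper colouring, with `c = 1`. -/
lemma sum_weighted_crossings [Fintype ι] (w : ι → ℕ) (c : ℕ)
    (hw : ∀ i j p, i ≠ j → p ∈ S.seg i → p ∈ S.seg j → w i + w j = c) (f : Plane → ℕ) :
    ∑ i, w i * ∑ t ∈ S.crossParams i, f (S.pt i t) = c * ∑ p ∈ S.crossFinset, f p := by
  classical
  have h1 : ∀ i, ∑ t ∈ S.crossParams i, f (S.pt i t) =
      ∑ p ∈ S.crossFinset, if p ∈ S.seg i then f p else 0 := by
    intro i
    rw [← Finset.sum_filter]
    refine Finset.sum_bij (fun t _ => S.pt i t) ?_ (fun s _ t _ h => S.pt_injective i h) ?_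
      (fun _ _ => rfl)
    · intro t ht
      obtain ⟨h0, j, hj, htj⟩ := S.mem_crossParams.1 ht
      have hm := S.pt_mem_seg (i := i).2 h0
      exact Finset.mem_filter.2 ⟨S.mem_crossFinset.2 ⟨i, j, hj.symm, hm, htj⟩, hm⟩
    · intro p hp
      obtain ⟨hpX, hpi⟩ := Finset.mem_filter.1 hp
      obtain ⟨j, k, hjk, hj, hk⟩ := S.mem_crossFinset.1 hpX
      have hpi' := hpi
      rw [seg_eq_image] at hpi'
      obtain ⟨t, ht, rfl⟩ := hpi'
      refine ⟨t, S.mem_crossParams.2 ⟨ht, ?_⟩, rfl⟩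
      by_cases hji : j = i
      · exact ⟨k, fun h => hjk (hji.trans h.symm), hk⟩
      · exact ⟨j, hji, hj⟩
  simp_rw [h1, Finset.mul_sum]
  rw [Finset.sum_comm]
  refine Finset.sum_congr rfl fun p hp => ?_
  obtain ⟨i, j, hij, hi, hj⟩ := S.mem_crossFinset.1 hp
  rw [← Finset.sum_subset (Finset.subset_univ {i, j}), Finset.sum_pair hij, if_pos hi, if_pos hj,
    ← add_mul, hw i j p hij hi hj]
  intro k _ hk
  simp only [Finset.mem_insert, Finset.mem_singleton, not_or] at hk
  rw [if_neg, mul_zero]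
  intro hpk
  rcases S.no_triple i j k p hi hj hpk with h | h | h
  · exact hij h
  · exact hk.1 h.symm
  · exact hk.2 h.symm

open Classical in
/-- The number of corners of `F` at the crossing `p` of the segments `i` and `j`. -/
noncomputable def cornerCount (F : Set Plane) (i j : ι) (p : Plane) : ℕ :=
  ∑ σ ∈ signs, ∑ τ ∈ signs, if F ∈ 𝓝[S.sector i j σ τ p] p then 1 else 0

lemma cornerCount_swap (F : Set Plane) (i j : ι) (p : Plane) :
    S.cornerCount F i j p = S.cornerCount F j i p := by
  unfold cornerCount
  rw [Finset.sum_comm]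
  refine Finset.sum_congr rfl fun σ _ => Finset.sum_congr rfl fun τ _ => ?_
  rw [S.sector_swap i j]

open Classical in
/-- The number of corners of `F` at the crossing `p`. -/
noncomputable def corners (F : Set Plane) (p : Plane) : ℕ :=
  if h : p ∈ S.crossings then S.cornerCount F h.choose h.choose_spec.choose p else 0

/-- No three segments meet, so the chosen pair is the given one up to order, which does not affect
the count. -/
lemma corners_eq (F : Set Plane) {i j : ι} {p : Plane} (hij : i ≠ j) (hi : p ∈ S.seg i)
    (hj : p ∈ S.seg j) : S.corners F p = S.cornerCount F i j p := by
  have h : p ∈ S.crossings := ⟨i, j, hij, hi, hj⟩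
  rw [corners, dif_pos h]
  obtain ⟨h1, h2, h3⟩ := h.choose_spec.choose_spec
  generalize h.choose_spec.choose = l at *
  generalize h.choose = k at *
  rcases S.no_triple i j k p hi hj h2 with e | e | e
  · exact absurd e hij
  · subst e
    rcases S.no_triple i j l p hi hj h3 with e | e | e
    · exact absurd e hij
    · exact absurd e h1
    · rw [e]
  · subst e
    rcases S.no_triple i j l p hi hj h3 with e | e | e
    · exact absurd e hij
    · rw [e, cornerCount_swap]
    · exact absurd e h1

-- Each of the four sectors is seen once from `i`: from one of its sides, either just after or just
-- before the crossing.
open Classical in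
lemma IsFace.corners_eq_sum [Finite ι] {F : Set Plane} (hF : S.IsFace F) {i : ι} {t : ℝ}
    (ht : t ∈ S.crossParams i) : S.corners F (S.pt i t) = ∑ σ ∈ signs,
      ((if ∀ᶠ s in 𝓝[>] t, S.Side F i σ s then 1 else 0) +
        (if ∀ᶠ s in 𝓝[<] t, S.Side F i σ s then 1 else 0)) := by
  obtain ⟨h0, j, hj, htj⟩ := S.mem_crossParams.1 ht
  have hm := S.pt_mem_seg (i := i).2 h0
  rw [S.corners_eq F hj.symm hm htj, cornerCount]
  refine Finset.sum_congr rfl fun σ hσ => ?_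
  rw [sum_signs]
  have hσ0 := ne_zero_of_mem_signs hσ
  rcases lt_or_gt_of_ne (S.cross_dir_ne_zero hj htj hm) with h | h
  · rw [hF.side_right_iff_sector hj.symm (τ := -1) hσ0 hm htj (by linarith),
      hF.side_left_iff_sector hj.symm (τ := 1) hσ0 hm htj (by linarith), add_comm]
  · rw [hF.side_right_iff_sector hj.symm (τ := 1) hσ0 hm htj (by linarith),
      hF.side_left_iff_sector hj.symm (τ := -1) hσ0 hm htj (by linarith)]

open Classical in
/-- The number of the two sides of the piece of the segment `i` between the parameters in `ab`
that belong to `F`. -/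
noncomputable def sideCount (F : Set Plane) (i : ι) (ab : ℝ × ℝ) : ℕ :=
  ∑ σ ∈ signs, if S.Side F i σ ((ab.1 + ab.2) / 2) then 1 else 0

open Classical in
/-- The number of endpoints of the segment `i` in the interior of the closure of `F`. -/
noncomputable def endCount (F : Set Plane) (i : ι) : ℕ :=
  (if S.src i ∈ interior (closure F) then 1 else 0) +
    (if S.tgt i ∈ interior (closure F) then 1 else 0)

open Classical in
/-- The number of pieces of the segment `i` on the polygon of `F`. -/
noncomputable def boundaryCount [Finite ι] (F : Set Plane) (i : ι) : ℕ :=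
  Finset.card {ab ∈ consecutivePairs (S.params i) |
    segment ℝ (S.pt i ab.1) (S.pt i ab.2) ⊆ frontier (closure F)}

lemma midpoint_mem_Ioo {a b : ℝ} (h : a < b) : (a + b) / 2 ∈ Ioo a b := by
  constructor <;> linarith

variable {S}

/-- A side of a piece can be read off at its lower or at its upper end. Adding both readings
collects the corners at the crossings and, at parameters 0 and 1, the endpoints, once for each of
the two signs. -/
lemma IsFace.two_mul_sum_sideCount [Finite ι] {F : Set Plane} (hF : S.IsFace F) (i : ι) :
    2 * ∑ ab ∈ consecutivePairs (S.params i), S.sideCount F i ab =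
      2 * S.endCount F i + ∑ t ∈ S.crossParams i, S.corners F (S.pt i t) := by
  classical
  have h1 : (1 : ℝ) ∈ S.params i := by simp [params]
  have h0 : (0 : ℝ) ∈ S.params i := by simp [params]
  have n1 : (1 : ℝ) ∉ S.crossParams i := fun h => lt_irrefl _ (S.crossParams_subset_Ioo h).2
  have n0 : (0 : ℝ) ∉ S.crossParams i := fun h => lt_irrefl _ (S.crossParams_subset_Ioo h).1
  have key : ∀ σ ∈ signs, 2 * ∑ ab ∈ consecutivePairs (S.params i),
      (if S.Side F i σ ((ab.1 + ab.2) / 2) then 1 else 0) = S.endCount F i +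
        ∑ t ∈ S.crossParams i, ((if ∀ᶠ s in 𝓝[>] t, S.Side F i σ s then 1 else 0) +
        (if ∀ᶠ s in 𝓝[<] t, S.Side F i σ s then 1 else 0)) := by
    intro σ hσ
    have hσ0 := ne_zero_of_mem_signs hσ
    have e1 := sum_consecutivePairs_fst h1 (fun x hx => (S.params_subset_Icc hx).2)
      (fun t => if ∀ᶠ s in 𝓝[>] t, S.Side F i σ s then 1 else 0)
    have e2 := sum_consecutivePairs_snd h0 (fun x hx => (S.params_subset_Icc hx).1)
      (fun t => if ∀ᶠ s in 𝓝[<] t, S.Side F i σ s then 1 else 0)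
    rw [erase_one_params, Finset.sum_insert n0] at e1
    rw [erase_zero_params, Finset.sum_insert n1] at e2
    have e3 : ∀ ab ∈ consecutivePairs (S.params i),
        (if ∀ᶠ s in 𝓝[>] ab.1, S.Side F i σ s then 1 else 0) =
          if S.Side F i σ ((ab.1 + ab.2) / 2) then 1 else 0 := by
      intro ab hab
      rw [hF.eventually_side_right hσ0 (S.regular_of_consecutivePairs hab)
        (midpoint_mem_Ioo (mem_consecutivePairs.1 hab).2.1)]
    have e4 : ∀ ab ∈ consecutivePairs (S.params i),
        (if ∀ᶠ s in 𝓝[<] ab.2, S.Side F i σ s then 1 else 0) =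
          if S.Side F i σ ((ab.1 + ab.2) / 2) then 1 else 0 := by
      intro ab hab
      rw [hF.eventually_side_left hσ0 (S.regular_of_consecutivePairs hab)
        (midpoint_mem_Ioo (mem_consecutivePairs.1 hab).2.1)]
    rw [Finset.sum_congr rfl e3] at e1
    rw [Finset.sum_congr rfl e4] at e2
    rw [two_mul]
    nth_rewrite 1 [e1]
    rw [e2, hF.side_right_iff_src i (mem_signs.1 hσ), hF.side_left_iff_tgt i (mem_signs.1 hσ),
      Finset.sum_add_distrib, endCount]
    ring
  have e5 : ∑ t ∈ S.crossParams i, S.corners F (S.pt i t) = _ :=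
    Finset.sum_congr rfl fun t ht => hF.corners_eq_sum S ht
  rw [e5, Finset.sum_comm]
  unfold sideCount
  rw [Finset.sum_comm, Finset.mul_sum, Finset.sum_congr rfl key, Finset.sum_add_distrib]
  congr 1
  rw [sum_signs, two_mul]

lemma IsFace.even_sum_corners [Finite ι] {F : Set Plane} (hF : S.IsFace F) (i : ι) :
    Even (∑ t ∈ S.crossParams i, S.corners F (S.pt i t)) := by
  have h := hF.two_mul_sum_sideCount i
  rw [Nat.even_iff]
  omega

/-- A piece contributes an odd number of sides exactly when `F` is on just one side, that is, when
it lies on the polygon. -/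
lemma IsFace.sum_sideCount_mod_two [Finite ι] {F : Set Plane} (hF : S.IsFace F) (i : ι) :
    (∑ ab ∈ consecutivePairs (S.params i), S.sideCount F i ab) % 2 = S.boundaryCount F i % 2 := by
  classical
  rw [boundaryCount, Finset.card_filter]
  refine sum_mod_two_congr fun ab hab => ?_
  rw [hF.segment_subset_frontier_iff (S.regular_of_consecutivePairs hab)
        (midpoint_mem_Ioo (mem_consecutivePairs.1 hab).2.1), sideCount, sum_signs]
  by_cases h1 : S.Side F i 1 ((ab.1 + ab.2) / 2) <;>
    by_cases h2 : S.Side F i (-1) ((ab.1 + ab.2) / 2) <;> simp [h1, h2]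

/-- The complexity of a face has the parity of its number of corners. -/
lemma IsFace.complexity_mod_two [Fintype ι] {F : Set Plane} (hF : S.IsFace F) :
    (∑ i, (S.boundaryCount F i + S.endCount F i)) % 2 =
      (∑ p ∈ S.crossFinset, S.corners F p) % 2 := by
  have h1 := S.sum_weighted_crossings (fun _ => 1) 2 (fun _ _ _ _ _ _ => rfl) (S.corners F)
  have h2 : 2 * ∑ i, ∑ ab ∈ consecutivePairs (S.params i), S.sideCount F i ab =
      2 * ∑ i, S.endCount F i + 2 * ∑ p ∈ S.crossFinset, S.corners F p := by
    rw [← h1, Finset.mul_sum, Finset.mul_sum, ← Finset.sum_add_distrib]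
    refine Finset.sum_congr rfl fun i _ => ?_
    rw [hF.two_mul_sum_sideCount i, one_mul]
  have h3 : (∑ i, ∑ ab ∈ consecutivePairs (S.params i), S.sideCount F i ab) % 2 =
      (∑ i, S.boundaryCount F i) % 2 :=
    sum_mod_two_congr fun i _ => hF.sum_sideCount_mod_two i
  rw [Finset.sum_add_distrib]
  omega

/-- If the segments have a proper colouring with two colours, then every face has an even number of
corners. -/
lemma IsFace.even_corners_of_coloring [Fintype ι] {F : Set Plane} (hF : S.IsFace F)
    (χ : ι → Bool) (hχ : ∀ i j p, i ≠ j → p ∈ S.seg i → p ∈ S.seg j → χ i ≠ χ j) :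
    Even (∑ p ∈ S.crossFinset, S.corners F p) := by
  have h := S.sum_weighted_crossings (fun i => (χ i).toNat) 1 (fun i j p hij hi hj => by
    have := hχ i j p hij hi hj
    revert this
    cases χ i <;> cases χ j <;> simp) (S.corners F)
  rw [one_mul] at h
  rw [← h]
  exact Finset.even_sum _ fun i _ => (hF.even_sum_corners i).mul_left _

end SegmentArrangement

/-! ### View angles and their jumps. -/

namespace Plane

/-- The plane as the complex plane. -/
def toC (x : Plane) : ℂ := ⟨x 0, x 1⟩

lemma toC_sub (x y : Plane) : toC (x - y) = toC x - toC y := rfl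

lemma toC_add (x y : Plane) : toC (x + y) = toC x + toC y := rfl

lemma toC_smul (c : ℝ) (x : Plane) : toC (c • x) = c * toC x := by
  apply Complex.ext <;> simp [toC]

lemma toC_injective : Function.Injective toC := by
  intro x y h
  exact ext_iff'.2 ⟨congrArg Complex.re h, congrArg Complex.im h⟩

lemma toC_ne_zero {x : Plane} (h : x ≠ 0) : toC x ≠ 0 := fun h0 => h (toC_injective h0)

lemma continuous_toC : Continuous toC := by
  have : toC = fun x : Plane => (x 0 : ℂ) + (x 1 : ℂ) * Complex.I := by
    ext1 x; apply Complex.ext <;> simp [toC]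
  rw [this]
  fun_prop

lemma norm_toC (x : Plane) : ‖toC x‖ = ‖x‖ := by
  rw [EuclideanSpace.norm_eq, Complex.norm_def, Complex.normSq_apply]
  simp [toC, Fin.sum_univ_two, sq]

lemma im_toC_div_ne_zero {u v : Plane} (h : cross u v ≠ 0) : (toC v / toC u).im ≠ 0 := by
  have hu : u ≠ 0 := by
    rintro rfl
    simp [cross] at h
  have hn : Complex.normSq (toC u) ≠ 0 := by simpa using toC_ne_zero hu
  rw [Complex.div_im, ← sub_div]
  refine div_ne_zero ?_ hn
  have : (toC v).im * (toC u).re - (toC v).re * (toC u).im = cross u v := by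
    simp [toC, cross]; ring
  rwa [this]

/-- The angle, in `(-π, π]`, under which the segment from `a` to `b` is seen from `x`. -/
noncomputable def viewAngle (a b x : Plane) : ℝ := ((toC b - toC x) / (toC a - toC x)).arg

/-- The argument jumps only on the nonpositive real axis, and a nonpositive real ratio puts `x`
between `a` and `b`. -/
lemma continuousAt_viewAngle {a b x : Plane} (h : x ∉ segment ℝ a b) :
    ContinuousAt (viewAngle a b) x := by
  have hxa : x ≠ a := fun e => h (e ▸ left_mem_segment ..)
  have ha : toC a - toC x ≠ 0 := sub_ne_zero.2 (toC_injective.ne hxa.symm)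
  have hc : ContinuousAt (fun y => (toC b - toC y) / (toC a - toC y)) x :=
    (continuousAt_const.sub continuous_toC.continuousAt).div
      (continuousAt_const.sub continuous_toC.continuousAt) ha
  refine ContinuousAt.comp (g := Complex.arg) (Complex.continuousAt_arg ?_) hc
  by_contra hs
  rw [Complex.mem_slitPlane_iff_not_le_zero, not_not] at hs
  apply h
  set r := (toC b - toC x) / (toC a - toC x) with hr
  obtain ⟨hre, him⟩ := hs
  simp only [Complex.zero_re, Complex.zero_im] at hre him
  have hrr : r = ((r.re : ℝ) : ℂ) := Complex.ext (by simp) (by simp [him])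
  have e1 : toC b - toC x = (r.re : ℂ) * (toC a - toC x) := by
    rw [← hrr, hr, div_mul_cancel₀ _ ha]
  set k := -r.re with hk
  have hk0 : 0 ≤ k := by linarith
  have h1k : 0 < 1 + k := by linarith
  -- These weights solve `b - x = -k • (a - x)` for `x`.
  refine ⟨k / (1 + k), 1 / (1 + k), by positivity, by positivity, by field_simp; ring, ?_⟩
  have e2 : b - x = (-k) • (a - x) := by
    apply toC_injective
    rw [toC_smul, toC_sub, toC_sub, e1, hk, neg_neg]
  have e3 : (1 + k) • x = k • a + b := by
    have : b = x + (-k) • (a - x) := by rw [← e2]; abel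
    rw [this]
    module
  have e4 : x = (1 + k)⁻¹ • (k • a + b) := by
    rw [← e3, smul_smul, inv_mul_cancel₀ h1k.ne', one_smul]
  conv_rhs => rw [e4]
  rw [smul_add, smul_smul, div_eq_inv_mul, div_eq_inv_mul, mul_one]

lemma coe_viewAngle {a b x : Plane} (ha : x ≠ a) (hb : x ≠ b) :
    (viewAngle a b x : Real.Angle) = (toC b - toC x).arg - (toC a - toC x).arg :=
  Complex.arg_div_coe_angle (sub_ne_zero.2 (toC_injective.ne hb.symm))
    (sub_ne_zero.2 (toC_injective.ne ha.symm))

/-- The ratio equals `1 + (b - a) / (a - x)`, which tends to 1 at infinity. -/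
lemma tendsto_viewAngle_cobounded (a b : Plane) :
    Tendsto (viewAngle a b) (Bornology.cobounded Plane) (𝓝 0) := by
  have h1 : Tendsto (fun x => toC a - toC x) (Bornology.cobounded Plane)
      (Bornology.cobounded ℂ) := by
    rw [← tendsto_norm_atTop_iff_cobounded]
    have : (fun x => ‖toC a - toC x‖) = fun x => ‖x - a‖ := by
      ext1 x
      rw [← toC_sub, norm_toC, norm_sub_rev]
    rw [this, tendsto_norm_atTop_iff_cobounded]
    simp [sub_eq_add_neg]
  have h2 : Tendsto (fun x => 1 + (toC b - toC a) * (toC a - toC x)⁻¹)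
      (Bornology.cobounded Plane) (𝓝 1) := by
    have := ((tendsto_inv₀_cobounded.comp h1).const_mul (toC b - toC a)).const_add 1
    simpa using this
  have h3 : Tendsto (fun x => (1 + (toC b - toC a) * (toC a - toC x)⁻¹).arg)
      (Bornology.cobounded Plane) (𝓝 0) := by
    have := (Complex.continuousAt_arg (x := 1) (by simp)).tendsto.comp h2
    simpa [Function.comp_def] using this
  refine h3.congr' ?_
  filter_upwards [h1.eventually_ne_cobounded 0] with x hx
  rw [viewAngle]
  congr 1
  field_simp
  ring

/-- The alternating sum of `f` over four points around `q`. -/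
noncomputable def alternatingSum (f : Plane → ℝ) (q u v : Plane) (ε : ℝ) : ℝ :=
  ∑ s ∈ signs, ∑ s' ∈ signs, s * s' * f (q + ε • (s • u + s' • v))

lemma alternatingSum_swap (f : Plane → ℝ) (q u v : Plane) :
    alternatingSum f q u v = alternatingSum f q v u := by
  ext1 ε
  unfold alternatingSum
  rw [Finset.sum_comm]
  refine Finset.sum_congr rfl fun s _ => Finset.sum_congr rfl fun s' _ => ?_
  rw [add_comm (s' • u), mul_comm s' s]

lemma alternatingSum_add (f g : Plane → ℝ) (q u v : Plane) (ε : ℝ) :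
    alternatingSum (fun x => f x + g x) q u v ε =
      alternatingSum f q u v ε + alternatingSum g q u v ε := by
  simp only [alternatingSum, mul_add, Finset.sum_add_distrib]

lemma tendsto_alternatingSum {f : Plane → ℝ} {q u v : Plane} {L : ℝ → ℝ → ℝ}
    (h : ∀ s ∈ signs, ∀ s' ∈ signs,
      Tendsto (fun ε : ℝ => f (q + ε • (s • u + s' • v))) (𝓝[>] 0) (𝓝 (L s s'))) :
    Tendsto (alternatingSum f q u v) (𝓝[>] 0)
      (𝓝 (∑ s ∈ signs, ∑ s' ∈ signs, s * s' * L s s')) :=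
  tendsto_finsetSum _ fun s hs => tendsto_finsetSum _ fun s' hs' => (h s hs s' hs').const_mul _

lemma tendsto_ray (q w : Plane) : Tendsto (fun ε : ℝ => q + ε • w) (𝓝[>] 0) (𝓝 q) := by
  refine tendsto_nhdsWithin_of_tendsto_nhds ?_
  have : Continuous fun ε : ℝ => q + ε • w := by fun_prop
  simpa using this.tendsto 0

lemma tendsto_alternatingSum_of_continuousAt {f : Plane → ℝ} {q : Plane} (u v : Plane)
    (h : ContinuousAt f q) : Tendsto (alternatingSum f q u v) (𝓝[>] 0) (𝓝 0) := by
  have := tendsto_alternatingSum (f := f) (q := q) (u := u) (v := v) (L := fun _ _ => f q)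
    fun s _ s' _ => h.tendsto.comp (tendsto_ray q _)
  simpa [sum_signs] using this

lemma tendsto_ofReal_zero : Tendsto (fun ε : ℝ => (ε : ℂ)) (𝓝[>] 0) (𝓝 0) := by
  refine tendsto_nhdsWithin_of_tendsto_nhds ?_
  simpa using Complex.continuous_ofReal.tendsto 0

/-- Near an inner point of a segment the angle tends to `π` or `-π` depending only on the side of
the segment, so the alternating signs along `u` cancel it. Asking only `0 < α * β` covers both
orientations. -/
lemma tendsto_alternatingSum_viewAngle_through {q u v : Plane} (h : cross u v ≠ 0) {α β : ℝ}
    (hαβ : 0 < α * β) :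
    Tendsto (alternatingSum (viewAngle (q + (-α) • u) (q + β • u)) q u v) (𝓝[>] 0) (𝓝 0) := by
  have hu : u ≠ 0 := by
    rintro rfl
    simp [cross] at h
  have hU := toC_ne_zero hu
  set z := toC v / toC u with hz
  have hzim : z.im ≠ 0 := im_toC_div_ne_zero h
  have hV : toC v = z * toC u := by rw [hz, div_mul_cancel₀ _ hU]
  have hα : α ≠ 0 := left_ne_zero_of_mul hαβ.ne'
  have hab : α + β ≠ 0 := by
    intro h0
    have : β = -α := by linarith
    subst this
    nlinarith [sq_nonneg α]
  have hneg : -β / α < 0 := by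
    have h2 : 0 < α * α := mul_self_pos.2 hα
    have : -β / α = -(α * β) / (α * α) := by field_simp
    rw [this]
    exact div_neg_of_neg_of_pos (by linarith) h2
  have hratio : ∀ ε s s' : ℝ,
      viewAngle (q + (-α) • u) (q + β • u) (q + ε • (s • u + s' • v)) =
        ((β - ε * (s + s' * z)) / (-α - ε * (s + s' * z))).arg := by
    intro ε s s'
    unfold viewAngle
    congr 1
    simp only [toC_add, toC_smul, hV]
    rw [← mul_div_mul_right (β - ε * (s + s' * z)) (-α - ε * (s + s' * z)) hU]
    congr 1
    · ring
    · push_cast; ring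
  have htend : ∀ s s' : ℝ, Tendsto (fun ε : ℝ => (β - ε * (s + s' * z)) / (-α - ε * (s + s' * z)))
      (𝓝[>] 0) (𝓝 ((-β / α : ℝ) : ℂ)) := by
    intro s s'
    have h1 : Tendsto (fun ε : ℝ => (β : ℂ) - ε * (s + s' * z)) (𝓝[>] 0) (𝓝 β) := by
      simpa using (tendsto_ofReal_zero.mul_const ((s : ℂ) + s' * z)).const_sub (β : ℂ)
    have h2 : Tendsto (fun ε : ℝ => -(α : ℂ) - ε * (s + s' * z)) (𝓝[>] 0) (𝓝 (-α)) := by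
      simpa using (tendsto_ofReal_zero.mul_const ((s : ℂ) + s' * z)).const_sub (-α : ℂ)
    have h3 : ((-β / α : ℝ) : ℂ) = β / -α := by
      push_cast
      rw [div_neg, neg_div]
    rw [h3]
    exact h1.div h2 (by simpa using hα)
  have him : ∀ ε s s' : ℝ, ((β - ε * (s + s' * z)) / (-α - ε * (s + s' * z))).im =
      ε * (s' * z.im * (α + β)) / Complex.normSq (-α - ε * (s + s' * z)) := by
    intro ε s s'
    rw [Complex.div_im, ← sub_div]
    congr 1
    simp
    ring
  have hden : ∀ s s' : ℝ, s' ≠ 0 → ∀ ε : ℝ, 0 < ε →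
      0 < Complex.normSq (-α - ε * (s + s' * z)) := by
    intro s s' hs' ε hε
    rw [Complex.normSq_pos]
    intro h0
    have := congrArg Complex.im h0
    simp [hε.ne', hs', hzim] at this
  let L : ℝ → ℝ → ℝ := fun _ s' => if 0 < s' * z.im * (α + β) then Real.pi else -Real.pi
  have key : ∀ s ∈ signs, ∀ s' ∈ signs, Tendsto (fun ε : ℝ =>
      viewAngle (q + (-α) • u) (q + β • u) (q + ε • (s • u + s' • v))) (𝓝[>] 0)
        (𝓝 (L s s')) := by
    intro s _ s' hs'
    have hs'0 := ne_zero_of_mem_signs hs'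
    simp only [hratio, L]
    split_ifs with hpos
    · have h1 := Complex.continuousWithinAt_arg_of_re_neg_of_im_zero
        (z := ((-β / α : ℝ) : ℂ)) (by simpa using hneg) (by simp)
      have h2 := h1.tendsto
      rw [Complex.arg_ofReal_of_neg hneg] at h2
      refine h2.comp (tendsto_nhdsWithin_iff.2 ⟨htend s s', ?_⟩)
      filter_upwards [self_mem_nhdsWithin] with ε hε
      rw [him]
      have := hden s s' hs'0 ε hε
      have hε : 0 < ε := hε
      positivity
    · have hlt : s' * z.im * (α + β) < 0 :=
        lt_of_le_of_ne (not_lt.1 hpos) (mul_ne_zero (mul_ne_zero hs'0 hzim) hab)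
      have h1 := Complex.tendsto_arg_nhdsWithin_im_neg_of_re_neg_of_im_zero
        (z := ((-β / α : ℝ) : ℂ)) (by simpa using hneg) (by simp)
      refine h1.comp (tendsto_nhdsWithin_iff.2 ⟨htend s s', ?_⟩)
      filter_upwards [self_mem_nhdsWithin] with ε hε
      rw [him]
      exact div_neg_of_neg_of_pos (mul_neg_of_pos_of_neg hε hlt) (hden s s' hs'0 ε hε)
  have hL : ∑ s ∈ signs, ∑ s' ∈ signs, s * s' * L s s' = 0 := by
    simp only [sum_signs, L]
    ring
  have := tendsto_alternatingSum key
  rwa [hL] at this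

lemma arg_mem_Ioo_of_im_pos {z : ℂ} (h : 0 < z.im) : 0 < z.arg ∧ z.arg < Real.pi := by
  refine ⟨lt_of_le_of_ne (Complex.arg_nonneg_iff.2 h.le) fun h0 => ?_,
    lt_of_le_of_ne (Complex.arg_le_pi z) fun h0 => ?_⟩
  · exact h.ne' (Complex.arg_eq_zero_iff.1 h0.symm).2
  · exact h.ne' (Complex.arg_eq_pi_iff.1 h0).2

lemma arg_mem_Ioo_of_im_neg {z : ℂ} (h : z.im < 0) : -Real.pi < z.arg ∧ z.arg < 0 :=
  ⟨Complex.neg_pi_lt_arg z, Complex.arg_neg_iff.2 h⟩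

lemma exists_arg_add_arg_div {w z : ℂ} (hw : w ≠ 0) (hz : z ≠ 0) :
    ∃ k : ℤ, w.arg + (z / w).arg = z.arg + 2 * Real.pi * k := by
  have : ((w.arg + (z / w).arg : ℝ) : Real.Angle) = (z.arg : ℝ) := by
    rw [Real.Angle.coe_add, Complex.arg_div_coe_angle hz hw]
    abel
  obtain ⟨k, hk⟩ := Real.Angle.angle_eq_iff_two_pi_dvd_sub.1 this
  exact ⟨k, by linarith⟩

lemma int_eq_of_lt {k n : ℤ} (h1 : 2 * Real.pi * (n - 1) < 2 * Real.pi * k)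
    (h2 : 2 * Real.pi * k < 2 * Real.pi * (n + 1)) : k = n := by
  have hpi : 0 < 2 * Real.pi := Real.two_pi_pos
  have h1 := lt_of_mul_lt_mul_left h1 hpi.le
  have h2 := lt_of_mul_lt_mul_left h2 hpi.le
  have h1' : n - 1 < k := by exact_mod_cast h1
  have h2' : k < n + 1 := by exact_mod_cast h2
  omega

/-- Around the corner of a path, the angle under which the path is seen jumps once. -/
lemma exists_odd_sum_arg {z : ℂ} (hz : z.im ≠ 0) : ∃ n : ℤ, Odd n ∧
    ∑ s ∈ signs, ∑ s' ∈ signs, s * s' * (((s : ℂ) + s' * z).arg + (z / (s + s' * z)).arg) =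
      2 * Real.pi * n := by
  have hz0 : z ≠ 0 := by rintro rfl; simp at hz
  have hw0 : ∀ s s' : ℝ, s' ≠ 0 → (s : ℂ) + s' * z ≠ 0 := by
    intro s s' hs' h
    have := congrArg Complex.im h
    simp [hs', hz] at this
  have him1 : ∀ s s' : ℝ, ((s : ℂ) + s' * z).im = s' * z.im := by
    intro s s'; simp
  have him2 : ∀ s s' : ℝ, (z / (s + s' * z)).im = s * z.im / Complex.normSq (s + s' * z) := by
    intro s s'
    rw [Complex.div_im, ← sub_div]
    congr 1
    simp
    ring
  have hn : ∀ s s' : ℝ, s' ≠ 0 → 0 < Complex.normSq (s + s' * z) :=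
    fun s s' h => Complex.normSq_pos.2 (hw0 s s' h)
  have hpi := Real.pi_pos
  obtain ⟨k1, e1⟩ := exists_arg_add_arg_div (hw0 1 1 (by norm_num)) hz0
  obtain ⟨k2, e2⟩ := exists_arg_add_arg_div (hw0 1 (-1) (by norm_num)) hz0
  obtain ⟨k3, e3⟩ := exists_arg_add_arg_div (hw0 (-1) 1 (by norm_num)) hz0
  obtain ⟨k4, e4⟩ := exists_arg_add_arg_div (hw0 (-1) (-1) (by norm_num)) hz0
  -- The copies of `z.arg` cancel in the alternating sum. Signs of imaginary parts confine the
  -- arguments so that `k1 = k2 = k3 = 0`, while `k4`, belonging to the point `-1 - z` between the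
  -- two legs, is 1 or -1.
  refine ⟨k1 - k2 - k3 + k4, ?_, ?_⟩
  · have pos2 : ∀ s s' : ℝ, s' ≠ 0 → 0 < s * z.im → 0 < (z / (s + s' * z)).im := by
      intro s s' h h1
      rw [him2]
      exact div_pos h1 (hn s s' h)
    have neg2 : ∀ s s' : ℝ, s' ≠ 0 → s * z.im < 0 → (z / (s + s' * z)).im < 0 := by
      intro s s' h h1
      rw [him2]
      exact div_neg_of_neg_of_pos h1 (hn s s' h)
    rcases lt_or_gt_of_ne hz with h | h
    · have a0 := arg_mem_Ioo_of_im_neg h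
      have a1 := arg_mem_Ioo_of_im_neg (z := ((1 : ℝ) : ℂ) + (1 : ℝ) * z) (by rw [him1]; linarith)
      have a2 := arg_mem_Ioo_of_im_pos (z := ((1 : ℝ) : ℂ) + (-1 : ℝ) * z) (by rw [him1]; linarith)
      have a3 := arg_mem_Ioo_of_im_neg (z := ((-1 : ℝ) : ℂ) + (1 : ℝ) * z) (by rw [him1]; linarith)
      have a4 := arg_mem_Ioo_of_im_pos (z := ((-1 : ℝ) : ℂ) + (-1 : ℝ) * z)
        (by rw [him1]; linarith)
      have b1 := arg_mem_Ioo_of_im_neg (neg2 1 1 (by norm_num) (by linarith))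
      have b2 := arg_mem_Ioo_of_im_neg (neg2 1 (-1) (by norm_num) (by linarith))
      have b3 := arg_mem_Ioo_of_im_pos (pos2 (-1) 1 (by norm_num) (by linarith))
      have b4 := arg_mem_Ioo_of_im_pos (pos2 (-1) (-1) (by norm_num) (by linarith))
      have f1 : k1 = 0 := int_eq_of_lt (by push_cast; linarith) (by push_cast; linarith)
      have f2 : k2 = 0 := int_eq_of_lt (by push_cast; linarith) (by push_cast; linarith)
      have f3 : k3 = 0 := int_eq_of_lt (by push_cast; linarith) (by push_cast; linarith)
      have f4 : k4 = 1 := int_eq_of_lt (by push_cast; linarith) (by push_cast; linarith)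
      rw [f1, f2, f3, f4]
      decide
    · have a0 := arg_mem_Ioo_of_im_pos h
      have a1 := arg_mem_Ioo_of_im_pos (z := ((1 : ℝ) : ℂ) + (1 : ℝ) * z) (by rw [him1]; linarith)
      have a2 := arg_mem_Ioo_of_im_neg (z := ((1 : ℝ) : ℂ) + (-1 : ℝ) * z) (by rw [him1]; linarith)
      have a3 := arg_mem_Ioo_of_im_pos (z := ((-1 : ℝ) : ℂ) + (1 : ℝ) * z) (by rw [him1]; linarith)
      have a4 := arg_mem_Ioo_of_im_neg (z := ((-1 : ℝ) : ℂ) + (-1 : ℝ) * z)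
        (by rw [him1]; linarith)
      have b1 := arg_mem_Ioo_of_im_pos (pos2 1 1 (by norm_num) (by linarith))
      have b2 := arg_mem_Ioo_of_im_pos (pos2 1 (-1) (by norm_num) (by linarith))
      have b3 := arg_mem_Ioo_of_im_neg (neg2 (-1) 1 (by norm_num) (by linarith))
      have b4 := arg_mem_Ioo_of_im_neg (neg2 (-1) (-1) (by norm_num) (by linarith))
      have f1 : k1 = 0 := int_eq_of_lt (by push_cast; linarith) (by push_cast; linarith)
      have f2 : k2 = 0 := int_eq_of_lt (by push_cast; linarith) (by push_cast; linarith)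
      have f3 : k3 = 0 := int_eq_of_lt (by push_cast; linarith) (by push_cast; linarith)
      have f4 : k4 = -1 := int_eq_of_lt (by push_cast; linarith) (by push_cast; linarith)
      rw [f1, f2, f3, f4]
      decide
  · rw [sum_signs, sum_signs, sum_signs, e1, e2, e3, e4]
    push_cast
    ring

/-- In the coordinate with `u = 1` and `v = z`, seen from `p + ε • w` the two legs subtend angles
tending to `w.arg` and `(z / w).arg`, which reduces the claim to `exists_odd_sum_arg`. -/
lemma exists_tendsto_alternatingSum_corner {p u v : Plane} (h : cross u v ≠ 0) {α β : ℝ}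
    (hα : 0 < α) (hβ : 0 < β) : ∃ n : ℤ, Odd n ∧
    Tendsto (alternatingSum (fun x => viewAngle (p + (-α) • u) p x + viewAngle p (p + (-β) • v) x)
      p u v) (𝓝[>] 0) (𝓝 (2 * Real.pi * n)) := by
  have hu : u ≠ 0 := by
    rintro rfl
    simp [cross] at h
  have hU := toC_ne_zero hu
  set z := toC v / toC u with hz
  have hzim : z.im ≠ 0 := im_toC_div_ne_zero h
  have hV : toC v = z * toC u := by rw [hz, div_mul_cancel₀ _ hU]
  obtain ⟨n, hn, hsum⟩ := exists_odd_sum_arg hzim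
  refine ⟨n, hn, ?_⟩
  rw [← hsum]
  refine tendsto_alternatingSum fun s hs s' hs' => ?_
  have hs0 := ne_zero_of_mem_signs hs
  have hs'0 := ne_zero_of_mem_signs hs'
  set w : ℂ := s + s' * z with hw
  have hwim : w.im ≠ 0 := by simp [hw, hs'0, hzim]
  have hw0 : w ≠ 0 := by
    intro h0
    rw [h0] at hwim
    simp at hwim
  have hαc : (α : ℂ) ≠ 0 := by exact_mod_cast hα.ne'
  refine Tendsto.add ?_ ?_
  · have h1 : Tendsto (fun ε : ℝ => w / (α + ε * w)) (𝓝[>] 0) (𝓝 (w / α)) := by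
      refine tendsto_const_nhds.div ?_ hαc
      simpa using (tendsto_ofReal_zero.mul_const w).const_add (α : ℂ)
    have h2 : w / α = ((α⁻¹ : ℝ) : ℂ) * w := by
      push_cast
      rw [div_eq_inv_mul]
    have h3 : w / α ∈ Complex.slitPlane := by
      rw [h2]
      right
      simp [hα.ne', hwim]
    have h4 := (Complex.continuousAt_arg h3).tendsto.comp h1
    rw [h2, Complex.arg_real_mul _ (inv_pos.2 hα)] at h4
    refine h4.congr' ?_
    filter_upwards [self_mem_nhdsWithin] with ε hε
    have hε : 0 < ε := hε
    rw [Function.comp_apply, ← Complex.arg_real_mul _ hε, viewAngle]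
    congr 1
    simp only [toC_add, toC_smul, hV]
    have e1 : toC p - (toC p + ε * (s * toC u + s' * (z * toC u))) = (ε * w) * (- toC u) := by
      rw [hw]; ring
    have e2 : toC p + ((-α : ℝ) : ℂ) * toC u - (toC p + ε * (s * toC u + s' * (z * toC u))) =
        (α + ε * w) * (- toC u) := by
      rw [hw]; push_cast; ring
    rw [e1, e2, mul_div_mul_right _ _ (neg_ne_zero.2 hU), mul_div_assoc]
  · have h1 : Tendsto (fun ε : ℝ => (β * z + ε * w) / w) (𝓝[>] 0) (𝓝 (β * z / w)) := by
      refine Tendsto.div ?_ tendsto_const_nhds hw0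
      simpa using (tendsto_ofReal_zero.mul_const w).const_add (β * z : ℂ)
    have h2 : β * z / w = (β : ℂ) * (z / w) := mul_div_assoc _ _ _
    have h3 : β * z / w ∈ Complex.slitPlane := by
      rw [h2]
      right
      have : (z / w).im = s * z.im / Complex.normSq w := by
        rw [Complex.div_im, ← sub_div]
        congr 1
        simp [hw]
        ring
      simp only [Complex.im_ofReal_mul, this]
      exact mul_ne_zero hβ.ne' (div_ne_zero (mul_ne_zero hs0 hzim)
        (Complex.normSq_pos.2 hw0).ne')
    have h4 := (Complex.continuousAt_arg h3).tendsto.comp h1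
    rw [h2, Complex.arg_real_mul _ hβ] at h4
    refine h4.congr' ?_
    filter_upwards [self_mem_nhdsWithin] with ε hε
    have hε : 0 < ε := hε
    rw [Function.comp_apply, ← Complex.arg_real_mul _ (inv_pos.2 hε), viewAngle]
    congr 1
    simp only [toC_add, toC_smul, hV]
    have hεc : (ε : ℂ) ≠ 0 := by exact_mod_cast hε.ne'
    have e1 : toC p - (toC p + ε * (s * toC u + s' * (z * toC u))) = (ε * w) * (- toC u) := by
      rw [hw]; ring
    have e2 : toC p + ((-β : ℝ) : ℂ) * (z * toC u) -
        (toC p + ε * (s * toC u + s' * (z * toC u))) = (β * z + ε * w) * (- toC u) := by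
      rw [hw]; push_cast; ring
    rw [e1, e2, mul_div_mul_right _ _ (neg_ne_zero.2 hU)]
    push_cast
    field_simp

end Plane

/-! ### Closed walks, winding numbers and colourability. -/

namespace SegmentArrangement

open Plane

variable {ι : Type*} (S : SegmentArrangement ι)

/-- Two segments are adjacent if they cross. -/
def crossingGraph : SimpleGraph ι where
  Adj i j := i ≠ j ∧ ∃ p, p ∈ S.seg i ∧ p ∈ S.seg j
  symm := ⟨fun _ _ ⟨h, p, hi, hj⟩ => ⟨h.symm, p, hj, hi⟩⟩
  loopless := ⟨fun _ h => h.1 rfl⟩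

open Classical in
/-- The common point of two segments that cross. -/
noncomputable def meet (i j : ι) : Plane :=
  if h : ∃ p, p ∈ S.seg i ∧ p ∈ S.seg j then h.choose else 0

variable {S} in
lemma meet_mem {i j : ι} (h : S.crossingGraph.Adj i j) :
    S.meet i j ∈ S.seg i ∧ S.meet i j ∈ S.seg j := by
  rw [meet, dif_pos h.2]
  exact h.2.choose_spec

/-- The angle under which the path from the source of `i` through the crossing with `j` to the
source of `j` is seen from `x`. -/
noncomputable def turnAngle (i j : ι) (x : Plane) : ℝ :=
  viewAngle (S.src i) (S.meet i j) x + viewAngle (S.meet i j) (S.src j) x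

lemma segment_src_subset {i : ι} {p : Plane} (hp : p ∈ S.seg i) :
    segment ℝ (S.src i) p ⊆ S.seg i :=
  (convex_segment _ _).segment_subset (S.src_mem_seg i) hp

lemma seg_subset_union (i : ι) : S.seg i ⊆ S.union := subset_iUnion _ i

variable {S}

lemma continuousAt_turnAngle {i j : ι} (h : S.crossingGraph.Adj i j) {x : Plane}
    (hx : x ∉ S.union) : ContinuousAt (S.turnAngle i j) x := by
  obtain ⟨hi, hj⟩ := meet_mem h
  refine (continuousAt_viewAngle fun h' => hx ?_).add (continuousAt_viewAngle fun h' => hx ?_)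
  · exact S.seg_subset_union i (S.segment_src_subset hi h')
  · rw [segment_symm] at h'
    exact S.seg_subset_union j (S.segment_src_subset hj h')

lemma coe_turnAngle {i j : ι} (h : S.crossingGraph.Adj i j) {x : Plane}
    (hx : x ∉ S.union) : (S.turnAngle i j x : Real.Angle) =
      (toC (S.src j) - toC x).arg - (toC (S.src i) - toC x).arg := by
  obtain ⟨hi, hj⟩ := meet_mem h
  have key : ∀ k p, p ∈ S.seg k → x ≠ p := fun k p hp e => hx (S.seg_subset_union k (e ▸ hp))
  rw [turnAngle, Real.Angle.coe_add, coe_viewAngle (key i _ (S.src_mem_seg i)) (key i _ hi),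
    coe_viewAngle (key j _ hj) (key j _ (S.src_mem_seg j))]
  abel

/-- The angle under which the path along a walk in the crossing graph is seen from `x`. -/
noncomputable def walkAngle {a b : ι} : S.crossingGraph.Walk a b → Plane → ℝ
  | .nil => fun _ => 0
  | .cons (v := j) _ w => fun x => S.turnAngle a j x + walkAngle w x

open Classical in
/-- How often a walk in the crossing graph turns at `q`. -/
noncomputable def turnCount (q : Plane) {a b : ι} : S.crossingGraph.Walk a b → ℤ
  | .nil => 0
  | .cons (v := j) _ w => (if S.meet a j = q then 1 else 0) + turnCount q w

lemma continuousAt_walkAngle {a b : ι} (w : S.crossingGraph.Walk a b) {x : Plane}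
    (hx : x ∉ S.union) : ContinuousAt (walkAngle w) x := by
  induction w with
  | nil => exact continuousAt_const
  | cons h w ih => exact (continuousAt_turnAngle h hx).add ih

lemma coe_walkAngle {a b : ι} (w : S.crossingGraph.Walk a b) {x : Plane}
    (hx : x ∉ S.union) : (walkAngle w x : Real.Angle) =
      (toC (S.src b) - toC x).arg - (toC (S.src a) - toC x).arg := by
  induction w with
  | nil => simp [walkAngle]
  | cons h w ih =>
    rw [walkAngle, Real.Angle.coe_add, coe_turnAngle h hx, ih]
    abel

lemma tendsto_walkAngle_cobounded {a b : ι} (w : S.crossingGraph.Walk a b) :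
    Tendsto (walkAngle w) (Bornology.cobounded Plane) (𝓝 0) := by
  induction w with
  | nil => exact tendsto_const_nhds
  | @cons i j _ h w ih =>
    have := ((tendsto_viewAngle_cobounded (S.src i) (S.meet i j)).add
      (tendsto_viewAngle_cobounded (S.meet i j) (S.src j))).add ih
    simp only [add_zero] at this
    exact this

lemma sum_turnCount [Finite ι] {a b : ι} (w : S.crossingGraph.Walk a b) :
    ∑ q ∈ S.crossFinset, turnCount q w = w.length := by
  induction w with
  | nil => simp [turnCount]
  | @cons i j k h w ih =>
    simp only [turnCount, Finset.sum_add_distrib, ih, SimpleGraph.Walk.length_cons]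
    obtain ⟨hi, hj⟩ := meet_mem h
    have hm : S.meet i j ∈ S.crossFinset := S.mem_crossFinset.2 ⟨i, j, h.1, hi, hj⟩
    rw [Finset.sum_ite_eq, if_pos hm]
    push_cast
    ring

/-- The winding number of a closed walk in the crossing graph around the points of a face. -/
lemma IsFace.exists_winding {F : Set Plane} (hF : S.IsFace F) {a : ι}
    (w : S.crossingGraph.Walk a a) : ∃ n : ℤ, (∀ x ∈ F, walkAngle w x = 2 * Real.pi * n) ∧
      (¬ Bornology.IsBounded F → n = 0) := by
  have hpi := Real.pi_pos
  have hint : ∀ x ∈ F, ∃ n : ℤ, walkAngle w x = 2 * Real.pi * n := by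
    intro x hx
    have h := coe_walkAngle w (hF.subset hx)
    rw [sub_self, ← Real.Angle.coe_zero] at h
    obtain ⟨n, hn⟩ := Real.Angle.angle_eq_iff_two_pi_dvd_sub.1 h
    exact ⟨n, by rw [← hn, sub_zero]⟩
  have hcont : ContinuousOn (walkAngle w) F := fun x hx =>
    (continuousAt_walkAngle w (hF.subset hx)).continuousWithinAt
  have hle : ∀ x ∈ F, ∀ y ∈ F, ∀ n m : ℤ, walkAngle w x = 2 * Real.pi * n →
      walkAngle w y = 2 * Real.pi * m → ¬ n < m := by
    intro x hx y hy n m hn hm hnm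
    have hnm' : (n : ℝ) + 1 ≤ m := by exact_mod_cast hnm
    -- Two different multiples of `2π` on a connected face would force the value `2π (n + 1/2)`,
    -- which is not such a multiple.
    obtain ⟨z, hz, hz2⟩ := hF.isPreconnected.intermediate_value hx hy hcont
      (show 2 * Real.pi * (n + 1 / 2) ∈ _ by
        rw [hn, hm]
        constructor <;> gcongr <;> linarith)
    obtain ⟨k, hk⟩ := hint z hz
    rw [hk] at hz2
    have hk2 := mul_left_cancel₀ (by positivity) hz2
    have h1 : n < k := by
      have : (n : ℝ) < k := by linarith
      exact_mod_cast this
    have h2 : k < n + 1 := by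
      have : (k : ℝ) < n + 1 := by linarith
      exact_mod_cast this
    omega
  obtain ⟨x, hx⟩ : F.Nonempty := by
    obtain ⟨x, hx, rfl⟩ := hF
    exact ⟨x, mem_connectedComponentIn hx⟩
  obtain ⟨n, hn⟩ := hint x hx
  have hconst : ∀ y ∈ F, walkAngle w y = 2 * Real.pi * n := by
    intro y hy
    obtain ⟨m, hm⟩ := hint y hy
    have : m = n := le_antisymm (not_lt.1 (hle x hx y hy n m hn hm))
      (not_lt.1 (hle y hy x hx m n hm hn))
    rw [hm, this]
  refine ⟨n, hconst, fun hunb => ?_⟩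
  -- An unbounded face has points so far out that the total angle is below `2π` in absolute value.
  have hev := (tendsto_walkAngle_cobounded w).eventually
    (Metric.ball_mem_nhds (0 : ℝ) Real.two_pi_pos)
  have : ∃ y ∈ F, walkAngle w y ∈ Metric.ball (0 : ℝ) (2 * Real.pi) := by
    by_contra! hno
    refine hunb (Bornology.isBounded_def.2 ?_)
    filter_upwards [hev] with y hy hyF using hno y hyF hy
  obtain ⟨y, hy, hyb⟩ := this
  rw [hconst y hy, mem_ball_zero_iff, Real.norm_eq_abs, abs_lt] at hyb
  exact int_eq_of_lt (n := 0) (by push_cast; linarith) (by push_cast; linarith)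

lemma exists_param_of_mem_crossing {i j : ι} (hij : i ≠ j) {p : Plane} (hi : p ∈ S.seg i)
    (hj : p ∈ S.seg j) : ∃ t : ℝ, 0 < t ∧ p = S.pt i t := by
  have hi' := hi
  rw [seg_eq_image] at hi'
  obtain ⟨t, ht, rfl⟩ := hi'
  refine ⟨t, lt_of_le_of_ne ht.1 ?_, rfl⟩
  rintro rfl
  rw [pt_zero] at hj
  exact hij (S.src_mem i j hj)

/-- A crossing `q` is never an endpoint of an edge, so a leg that does not turn at `q` either misses
it, where the angle is continuous, or passes straight through. -/
lemma tendsto_alternatingSum_leg {i j e f : ι} (hij : i ≠ j) {q m : Plane}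
    (hi : q ∈ S.seg i) (hj : q ∈ S.seg j) (hef : e ≠ f) (hme : m ∈ S.seg e) (hmf : m ∈ S.seg f)
    (hqm : q ≠ m) :
    Tendsto (alternatingSum (viewAngle (S.src e) m) q (S.dir i) (S.dir j)) (𝓝[>] 0) (𝓝 0) ∧
    Tendsto (alternatingSum (viewAngle m (S.src e)) q (S.dir i) (S.dir j)) (𝓝[>] 0) (𝓝 0) := by
  by_cases hq : q ∈ segment ℝ (S.src e) m
  swap
  · refine ⟨tendsto_alternatingSum_of_continuousAt _ _ (continuousAt_viewAngle hq),
      tendsto_alternatingSum_of_continuousAt _ _ (continuousAt_viewAngle ?_)⟩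
    rwa [segment_symm]
  wlog hei : e = i generalizing i j
  · have hej : e = j := by
      rcases S.no_triple i j e q hi hj (S.segment_src_subset hme hq) with h | h | h
      · exact absurd h hij
      · exact absurd h.symm hei
      · exact h.symm
    rw [alternatingSum_swap (viewAngle (S.src e) m) q, alternatingSum_swap (viewAngle m (S.src e)) q]
    exact this hij.symm hj hi hej
  subst hei
  obtain ⟨t, ht, rfl⟩ := exists_param_of_mem_crossing hij hi hj
  obtain ⟨t', ht', rfl⟩ := exists_param_of_mem_crossing hef hme hmf
  have htt : t < t' := by
    rw [← pt_zero, S.segment_pt e ht'.le, (S.pt_injective e).mem_set_image] at hq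
    exact lt_of_le_of_ne hq.2 fun h => hqm (by rw [h])
  have h := S.cross_dir_ne_zero hij hi hj
  have e1 : S.src e = S.pt e t + (-t) • S.dir e := by
    rw [← pt_zero, S.pt_eq_add e 0 t, zero_sub]
  have e2 : S.pt e t' = S.pt e t + (t' - t) • S.dir e := S.pt_eq_add e t' t
  rw [e1, e2]
  constructor
  · exact tendsto_alternatingSum_viewAngle_through h (mul_pos ht (sub_pos.2 htt))
  -- The reversed leg: both parameters become negative, their product stays positive.
  · have := tendsto_alternatingSum_viewAngle_through (q := S.pt e t) h (α := -(t' - t)) (β := -t)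
      (by nlinarith [mul_pos ht (sub_pos.2 htt)])
    rwa [neg_neg] at this

/-- A turn at `q` uses exactly the two edges through `q`, and both legs lead to sources, hence leave
`q` against the directions; this is the corner configuration. Otherwise both legs contribute 0. -/
lemma exists_tendsto_alternatingSum_turnAngle {i j e f : ι} (hij : i ≠ j) {q : Plane}
    (hi : q ∈ S.seg i) (hj : q ∈ S.seg j) (hef : S.crossingGraph.Adj e f) :
    ∃ n : ℤ, (Odd n ↔ S.meet e f = q) ∧
      Tendsto (alternatingSum (S.turnAngle e f) q (S.dir i) (S.dir j)) (𝓝[>] 0)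
        (𝓝 (2 * Real.pi * n)) := by
  obtain ⟨hme, hmf⟩ := meet_mem hef
  by_cases hq : S.meet e f = q
  · wlog hei : e = i generalizing i j
    · have hej : e = j := by
        rcases S.no_triple i j e q hi hj (hq ▸ hme) with h | h | h
        · exact absurd h hij
        · exact absurd h.symm hei
        · exact h.symm
      rw [alternatingSum_swap _ q]
      exact this hij.symm hj hi hej
    subst hei
    have hfj : f = j := by
      rcases S.no_triple e j f q hi hj (hq ▸ hmf) with h | h | h
      · exact absurd h hij
      · exact absurd h hef.1
      · exact h.symm
    subst hfj
    obtain ⟨t, ht, hqt⟩ := exists_param_of_mem_crossing hij hi hj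
    obtain ⟨t', ht', hqt'⟩ := exists_param_of_mem_crossing hij.symm hj hi
    obtain ⟨n, hn, hlim⟩ := exists_tendsto_alternatingSum_corner (p := q)
      (S.cross_dir_ne_zero hij hi hj) ht ht'
    refine ⟨n, by simp [hn, hq], ?_⟩
    have e1 : q + (-t) • S.dir e = S.src e := by
      rw [hqt, pt]; module
    have e2 : q + (-t') • S.dir f = S.src f := by
      rw [hqt', pt]; module
    rw [e1, e2] at hlim
    unfold turnAngle
    rw [hq]
    exact hlim
  · refine ⟨0, by simp [hq], ?_⟩
    have h1 := (tendsto_alternatingSum_leg hij hi hj hef.1 hme hmf (Ne.symm hq)).1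
    have h2 := (tendsto_alternatingSum_leg hij hi hj hef.1.symm hmf hme (Ne.symm hq)).2
    have h3 := h1.add h2
    unfold turnAngle
    refine Tendsto.congr (fun ε => (alternatingSum_add _ _ _ _ _ _).symm) ?_
    simpa using h3

lemma exists_tendsto_alternatingSum_walkAngle {i j : ι} (hij : i ≠ j) {q : Plane}
    (hi : q ∈ S.seg i) (hj : q ∈ S.seg j) {a b : ι} (w : S.crossingGraph.Walk a b) :
    ∃ n : ℤ, n % 2 = turnCount q w % 2 ∧
      Tendsto (alternatingSum (walkAngle w) q (S.dir i) (S.dir j)) (𝓝[>] 0)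
        (𝓝 (2 * Real.pi * n)) := by
  induction w with
  | nil =>
    refine ⟨0, by simp [turnCount], ?_⟩
    rw [Int.cast_zero, mul_zero]
    exact tendsto_alternatingSum_of_continuousAt _ _ continuousAt_const
  | @cons e f k h w ih =>
    obtain ⟨n, hn, hlim⟩ := ih
    obtain ⟨n', hn', hlim'⟩ := exists_tendsto_alternatingSum_turnAngle hij hi hj h
    refine ⟨n' + n, ?_, ?_⟩
    · rw [turnCount]
      split_ifs with hq
      · have := Int.odd_iff.1 (hn'.2 hq)
        omega
      · have := Int.even_iff.1 (Int.not_odd_iff_even.1 (mt hn'.1 hq))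
        omega
    · have h3 := hlim'.add hlim
      refine Tendsto.congr (fun ε => (alternatingSum_add _ _ _ _ _ _).symm) ?_
      convert h3 using 2
      push_cast
      ring

variable (S)

lemma exists_face_sector [Finite ι] {i j : ι} (hij : i ≠ j) {p : Plane} (hi : p ∈ S.seg i)
    (hj : p ∈ S.seg j) {σ τ : ℝ} (hσ : σ ≠ 0) (hτ : τ ≠ 0) :
    ∃ F, S.IsFace F ∧ F ∈ 𝓝[S.sector i j σ τ p] p := by
  have hne := S.neBot_sector hij hi hj hσ hτ
  have hoff := S.sector_off hij hi hj σ τ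
  obtain ⟨r, hr, hsub⟩ := Metric.mem_nhdsWithin_iff.1 hoff
  obtain ⟨x, hx⟩ : (Metric.ball p r ∩ S.sector i j σ τ p).Nonempty :=
    hne.nonempty_of_mem (inter_mem (nhdsWithin_le_nhds (Metric.ball_mem_nhds p hr))
      self_mem_nhdsWithin)
  refine ⟨connectedComponentIn S.unionᶜ x, ⟨x, hsub hx, rfl⟩,
    Metric.mem_nhdsWithin_iff.2 ⟨r, hr, ?_⟩⟩
  exact ((convex_ball p r).inter (S.convex_sector _ _ _ _ _)).isPreconnected.subset_connectedComponentIn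
    hx hsub

variable {S}

lemma IsFace.eq_of_mem {F F' : Set Plane} (hF : S.IsFace F) (hF' : S.IsFace F') {x : Plane}
    (hx : x ∈ F) (hx' : x ∈ F') : F = F' := by
  obtain ⟨y, -, rfl⟩ := hF
  obtain ⟨y', -, rfl⟩ := hF'
  rw [connectedComponentIn_eq hx, connectedComponentIn_eq hx']

variable (S)

lemma tendsto_sector {i j : ι} {q : Plane} {s s' σ τ : ℝ}
    (hσ : 0 < σ * (s' * cross (S.dir i) (S.dir j)))
    (hτ : 0 < τ * (-s * cross (S.dir i) (S.dir j))) :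
    Tendsto (fun ε : ℝ => q + ε • (s • S.dir i + s' • S.dir j)) (𝓝[>] 0)
      (𝓝[S.sector i j σ τ q] q) := by
  refine tendsto_nhdsWithin_iff.2 ⟨tendsto_ray _ _, ?_⟩
  filter_upwards [self_mem_nhdsWithin] with ε hε
  have hε : 0 < ε := hε
  simp only [sector, halfPlane, mem_inter_iff, mem_ofPred_eq, add_sub_cancel_left]
  rw [cross_smul, cross_smul, cross_add, cross_add, cross_smul, cross_smul, cross_smul, cross_smul,
    cross_self, cross_self, cross_swap (S.dir j) (S.dir i)]
  constructor
  · nlinarith [mul_pos hε hσ]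
  · nlinarith [mul_pos hε hτ]

/-- At a crossing, the winding numbers of the four adjacent faces add up to the number of turns, up
to an even number. -/
lemma sum_winding_mod_two {i j : ι} (hij : i ≠ j) {q : Plane}
    (hi : q ∈ S.seg i) (hj : q ∈ S.seg j) {a : ι} (w : S.crossingGraph.Walk a a)
    (F : ℝ → ℝ → Set Plane) (V : ℝ → ℝ → ℤ)
    (hF : ∀ σ ∈ signs, ∀ τ ∈ signs, F σ τ ∈ 𝓝[S.sector i j σ τ q] q)
    (hV : ∀ σ ∈ signs, ∀ τ ∈ signs, ∀ x ∈ F σ τ, walkAngle w x = 2 * Real.pi * V σ τ) :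
    (∑ σ ∈ signs, ∑ τ ∈ signs, V σ τ) % 2 = turnCount q w % 2 := by
  obtain ⟨n, hn, hlim⟩ := exists_tendsto_alternatingSum_walkAngle hij hi hj w
  have h1 : (1 : ℝ) ∈ signs := mem_signs.2 (Or.inl rfl)
  have h2 : (-1 : ℝ) ∈ signs := mem_signs.2 (Or.inr rfl)
  have key : ∀ s s' : ℝ, ∀ σ ∈ signs, ∀ τ ∈ signs,
      0 < σ * (s' * cross (S.dir i) (S.dir j)) → 0 < τ * (-s * cross (S.dir i) (S.dir j)) →
      ∀ᶠ ε in 𝓝[>] (0 : ℝ), walkAngle w (q + ε • (s • S.dir i + s' • S.dir j)) =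
        2 * Real.pi * V σ τ := by
    intro s s' σ hσ τ hτ hc hc'
    filter_upwards [S.tendsto_sector hc hc' (hF σ hσ τ hτ)] with ε hε using hV σ hσ τ hτ _ hε
  -- The point with signs `s`, `s'` lies in the sector with `σ * τ = -(s * s')`, whatever the
  -- orientation of the two directions; so both cases give the same combination.
  have hev : ∀ᶠ ε in 𝓝[>] (0 : ℝ), alternatingSum (walkAngle w) q (S.dir i) (S.dir j) ε =
      2 * Real.pi * (V 1 (-1) - V (-1) (-1) - V 1 1 + V (-1) 1 : ℤ) := by
    rcases lt_or_gt_of_ne (S.cross_dir_ne_zero hij hi hj) with h | h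
    · filter_upwards [key 1 1 (-1) h2 1 h1 (by linarith) (by linarith),
        key 1 (-1) 1 h1 1 h1 (by linarith) (by linarith),
        key (-1) 1 (-1) h2 (-1) h2 (by linarith) (by linarith),
        key (-1) (-1) 1 h1 (-1) h2 (by linarith) (by linarith)] with ε a1 a2 a3 a4
      rw [alternatingSum, sum_signs, sum_signs, sum_signs, a1, a2, a3, a4]
      push_cast
      ring
    · filter_upwards [key 1 1 1 h1 (-1) h2 (by linarith) (by linarith),
        key 1 (-1) (-1) h2 (-1) h2 (by linarith) (by linarith),
        key (-1) 1 1 h1 1 h1 (by linarith) (by linarith),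
        key (-1) (-1) (-1) h2 1 h1 (by linarith) (by linarith)] with ε a1 a2 a3 a4
      rw [alternatingSum, sum_signs, sum_signs, sum_signs, a1, a2, a3, a4]
      push_cast
      ring
  have hlim2 := tendsto_nhds_unique hlim (tendsto_const_nhds.congr' (hev.mono fun ε h => h.symm))
  have hM := mul_left_cancel₀ Real.two_pi_pos.ne' hlim2
  have hM' : n = V 1 (-1) - V (-1) (-1) - V 1 1 + V (-1) 1 := by exact_mod_cast hM
  rw [sum_signs, sum_signs, sum_signs, ← hn, hM']
  omega

/-- If every bounded face has an even number of corners, then the segments have a proper colouring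
with two colours. -/
theorem crossingGraph_colorable [Finite ι]
    (h : ∀ F, S.IsFace F → Bornology.IsBounded F → Even (∑ p ∈ S.crossFinset, S.corners F p)) :
    S.crossingGraph.Colorable 2 := by
  classical
  rw [SimpleGraph.two_colorable_iff_forall_loop_even]
  intro a w
  have hpair : ∀ p : Plane, ∃ ij : ι × ι, p ∈ S.crossFinset →
      ij.1 ≠ ij.2 ∧ p ∈ S.seg ij.1 ∧ p ∈ S.seg ij.2 := by
    intro p
    by_cases hp : p ∈ S.crossFinset
    · obtain ⟨i, j, hp⟩ := S.mem_crossFinset.1 hp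
      exact ⟨(i, j), fun _ => hp⟩
    · exact ⟨(a, a), fun h => absurd h hp⟩
  choose I hI using hpair
  have hface : ∀ x : Plane × ℝ × ℝ, ∃ F, x ∈ S.crossFinset ×ˢ signs ×ˢ signs → S.IsFace F ∧
      F ∈ 𝓝[S.sector (I x.1).1 (I x.1).2 x.2.1 x.2.2 x.1] x.1 := by
    rintro ⟨p, σ, τ⟩
    by_cases hp : (p, σ, τ) ∈ S.crossFinset ×ˢ signs ×ˢ signs
    · have hp' := hp
      simp only [Finset.mem_product] at hp'
      obtain ⟨hij, hi, hj⟩ := hI p hp'.1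
      obtain ⟨F, hF⟩ := S.exists_face_sector hij hi hj (ne_zero_of_mem_signs hp'.2.1)
        (ne_zero_of_mem_signs hp'.2.2)
      exact ⟨F, fun _ => hF⟩
    · exact ⟨∅, fun h => absurd h hp⟩
  choose Φ hΦ using hface
  have hwind : ∀ F : Set Plane, ∃ n : ℤ, S.IsFace F →
      (∀ x ∈ F, walkAngle w x = 2 * Real.pi * n) ∧ (¬ Bornology.IsBounded F → n = 0) := by
    intro F
    by_cases hF : S.IsFace F
    · obtain ⟨n, hn⟩ := hF.exists_winding w
      exact ⟨n, fun _ => hn⟩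
    · exact ⟨0, fun h => absurd h hF⟩
  choose W hW using hwind
  have hcorners : ∀ F, S.IsFace F → ∀ p ∈ S.crossFinset, (S.corners F p : ℤ) =
      ∑ σ ∈ signs, ∑ τ ∈ signs, if Φ (p, σ, τ) = F then 1 else 0 := by
    intro F hF p hp
    obtain ⟨hij, hi, hj⟩ := hI p hp
    rw [S.corners_eq F hij hi hj, cornerCount]
    push_cast
    refine Finset.sum_congr rfl fun σ hσ => Finset.sum_congr rfl fun τ hτ => ?_
    obtain ⟨hΦ1, hΦ2⟩ := hΦ (p, σ, τ) (by simp [hp, hσ, hτ])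
    have hne := S.neBot_sector hij hi hj (ne_zero_of_mem_signs hσ) (ne_zero_of_mem_signs hτ)
    refine if_congr ⟨fun hFm => ?_, fun e => e ▸ hΦ2⟩ rfl rfl
    obtain ⟨x, hx1, hx2⟩ := (Eventually.and hFm hΦ2).exists
    exact hΦ1.eq_of_mem hF hx2 hx1
  let X := S.crossFinset ×ˢ signs ×ˢ signs
  -- Sectors at crossings are grouped by the face that fills them.
  have htotal : ∑ x ∈ X, W (Φ x) = ∑ F ∈ X.image Φ, W F * ∑ p ∈ S.crossFinset, S.corners F p := by
    have e1 : ∀ F ∈ X.image Φ, W F * ∑ p ∈ S.crossFinset, (S.corners F p : ℤ) =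
        ∑ x ∈ X, if Φ x = F then W F else 0 := by
      intro F hF
      obtain ⟨x, hx, rfl⟩ := Finset.mem_image.1 hF
      rw [Finset.sum_congr rfl (hcorners _ (hΦ x hx).1), Finset.mul_sum]
      simp only [X, Finset.sum_product, Finset.mul_sum, mul_ite, mul_one, mul_zero]
    push_cast
    rw [Finset.sum_congr rfl e1, Finset.sum_comm]
    refine Finset.sum_congr rfl fun x hx => ?_
    rw [Finset.sum_ite_eq, if_pos (Finset.mem_image_of_mem _ hx)]
  have heven : Even (∑ x ∈ X, W (Φ x)) := by
    rw [htotal]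
    refine Finset.even_sum _ fun F hF => ?_
    obtain ⟨x, hx, rfl⟩ := Finset.mem_image.1 hF
    by_cases hb : Bornology.IsBounded (Φ x)
    · exact (by exact_mod_cast h _ (hΦ x hx).1 hb : Even (_ : ℤ)).mul_left _
    · rw [(hW _ (hΦ x hx).1).2 hb, zero_mul]
      exact Even.zero
  have hlocal : ∀ p ∈ S.crossFinset,
      (∑ σ ∈ signs, ∑ τ ∈ signs, W (Φ (p, σ, τ))) % 2 = turnCount p w % 2 := by
    intro p hp
    obtain ⟨hij, hi, hj⟩ := hI p hp
    refine S.sum_winding_mod_two hij hi hj w (fun σ τ => Φ (p, σ, τ))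
      (fun σ τ => W (Φ (p, σ, τ))) (fun σ hσ τ hτ => ?_) (fun σ hσ τ hτ => ?_)
    · exact (hΦ (p, σ, τ) (by simp [hp, hσ, hτ])).2
    · exact (hW _ (hΦ (p, σ, τ) (by simp [hp, hσ, hτ])).1).1
  have hlen : (∑ x ∈ X, W (Φ x)) % 2 = (w.length : ℤ) % 2 := by
    rw [← sum_turnCount w]
    simp only [X, Finset.sum_product]
    rw [Finset.sum_int_mod, Finset.sum_congr rfl hlocal, ← Finset.sum_int_mod]
  rw [Int.even_iff, hlen] at heven
  rw [Nat.even_iff]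
  omega

end SegmentArrangement

/-! ### Pieces of segments as point sets. -/

namespace SegmentArrangement

open Plane

variable {ι : Type*} (S : SegmentArrangement ι)

lemma segment_pt_subset_seg {i : ι} {a b : ℝ} (ha : a ∈ Icc (0 : ℝ) 1) (hb : b ∈ Icc (0 : ℝ) 1) :
    segment ℝ (S.pt i a) (S.pt i b) ⊆ S.seg i :=
  (convex_segment _ _).segment_subset (S.pt_mem_seg.2 ha) (S.pt_mem_seg.2 hb)

lemma sbtw_pt_iff {i : ι} {a b : ℝ} (hab : a < b) {x : Plane} :
    Sbtw ℝ (S.pt i a) x (S.pt i b) ↔ ∃ c ∈ Ioo a b, S.pt i c = x := by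
  rw [Sbtw, ← mem_segment_iff_wbtw, S.segment_pt i hab.le]
  constructor
  · rintro ⟨⟨c, hc, rfl⟩, h1, h2⟩
    exact ⟨c, ⟨lt_of_le_of_ne hc.1 fun h => h1 (by rw [h]),
      lt_of_le_of_ne hc.2 fun h => h2 (by rw [h])⟩, rfl⟩
  · rintro ⟨c, hc, rfl⟩
    exact ⟨⟨c, Ioo_subset_Icc_self hc, rfl⟩, (S.pt_injective i).ne hc.1.ne',
      (S.pt_injective i).ne hc.2.ne⟩

/-- The midpoint of a piece is regular, so it lies on no other segment; hence the piece determines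
its carrier. -/
lemma eq_of_segment_eq [Finite ι] {i j : ι} {ab cd : ℝ × ℝ}
    (h1 : ab ∈ consecutivePairs (S.params i)) (h2 : cd ∈ consecutivePairs (S.params j))
    (h : segment ℝ (S.pt i ab.1) (S.pt i ab.2) = segment ℝ (S.pt j cd.1) (S.pt j cd.2)) :
    i = j ∧ ab = cd := by
  have hlt := (mem_consecutivePairs.1 h1).2.1
  have hlt' := (mem_consecutivePairs.1 h2).2.1
  have hij : i = j := by
    by_contra hne
    have hm := midpoint_mem_Ioo hlt
    refine (S.regular_of_consecutivePairs h1 _ hm).2 j (Ne.symm hne)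
      (S.segment_pt_subset_seg (S.params_subset_Icc (mem_consecutivePairs.1 h2).1.1)
        (S.params_subset_Icc (mem_consecutivePairs.1 h2).1.2) ?_)
    rw [← h, S.segment_pt i hlt.le]
    exact mem_image_of_mem _ (Ioo_subset_Icc_self hm)
  subst hij
  rw [S.segment_pt i hlt.le, S.segment_pt i hlt'.le, (S.pt_injective i).image_injective.eq_iff] at h
  have h3 : ab.1 ∈ Icc cd.1 cd.2 := h ▸ left_mem_Icc.2 hlt.le
  have h4 : ab.2 ∈ Icc cd.1 cd.2 := h ▸ right_mem_Icc.2 hlt.le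
  have h5 : cd.1 ∈ Icc ab.1 ab.2 := h ▸ left_mem_Icc.2 hlt'.le
  have h6 : cd.2 ∈ Icc ab.1 ab.2 := h ▸ right_mem_Icc.2 hlt'.le
  exact ⟨rfl, Prod.ext (le_antisymm h5.1 h3.1) (le_antisymm h4.2 h6.2)⟩

end SegmentArrangement

/-! ### From drawings to arrangements, and from casings to colourings. -/

namespace StraightLineDrawing

variable {V : Type*} {G : SimpleGraph V} (D : StraightLineDrawing G)

/-- The endpoints of an edge, in some order. -/
noncomputable def endpoints (e : G.edgeSet) : V × V := Quot.out (e : Sym2 V)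

lemma eq_mk_endpoints (e : G.edgeSet) : (e : Sym2 V) = s((endpoints e).1, (endpoints e).2) :=
  (Quot.out_eq (e : Sym2 V)).symm

lemma mem_iff_endpoints {e : G.edgeSet} {v : V} :
    v ∈ (e : Sym2 V) ↔ v = (endpoints e).1 ∨ v = (endpoints e).2 := by
  conv_lhs => rw [eq_mk_endpoints e]
  exact Sym2.mem_iff

lemma endpoints_ne (e : G.edgeSet) : (endpoints e).1 ≠ (endpoints e).2 := by
  have h := e.2
  rw [eq_mk_endpoints e, SimpleGraph.mem_edgeSet] at h
  exact h.ne

lemma edgeSegment_eq (e : G.edgeSet) :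
    D.edgeSegment e = segment ℝ (D.pos (endpoints e).1) (D.pos (endpoints e).2) := by
  have : {u | u ∈ (e : Sym2 V)} = {(endpoints e).1, (endpoints e).2} := by
    ext u
    simp [mem_iff_endpoints]
  rw [edgeSegment, this, image_pair, convexHull_pair]

lemma mem_of_pos_mem_edgeSegment {e : G.edgeSet} {v : V} (h : D.pos v ∈ D.edgeSegment e) :
    v ∈ (e : Sym2 V) := D.mem_of_pos_mem e e.2 v h

lemma edge_unique (hG : IsDegreeOneGraph G) {e f : G.edgeSet} {v : V} (he : v ∈ (e : Sym2 V))
    (hf : v ∈ (f : Sym2 V)) : e = f :=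
  Subtype.ext ((hG v).unique ⟨e.2, he⟩ ⟨f.2, hf⟩)

/-- The segments that draw the edges of a degree-one graph. -/
noncomputable def toArrangement (hG : IsDegreeOneGraph G) : SegmentArrangement G.edgeSet where
  src e := D.pos (endpoints e).1
  tgt e := D.pos (endpoints e).2
  src_ne_tgt e := D.pos_injective.ne (endpoints_ne e)
  src_mem e f h := edge_unique hG (mem_iff_endpoints.2 (Or.inl rfl))
    (D.mem_of_pos_mem_edgeSegment (by rwa [edgeSegment_eq]))
  tgt_mem e f h := edge_unique hG (mem_iff_endpoints.2 (Or.inr rfl))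
    (D.mem_of_pos_mem_edgeSegment (by rwa [edgeSegment_eq]))
  no_triple e f g p he hf hg := by
    rw [← edgeSegment_eq] at he hf hg
    by_contra! hne
    -- General position of the drawing excludes triple points only away from vertices; at a vertex,
    -- degree one makes the edges equal.
    by_cases hp : p ∈ Set.range D.pos
    · obtain ⟨v, rfl⟩ := hp
      exact hne.1 (edge_unique hG (D.mem_of_pos_mem_edgeSegment he)
        (D.mem_of_pos_mem_edgeSegment hf))
    · exact D.no_triple_crossing e e.2 f f.2 g g.2 (Subtype.coe_injective.ne hne.1)
        (Subtype.coe_injective.ne hne.2.1) (Subtype.coe_injective.ne hne.2.2) p hp ⟨he, hf, hg⟩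

variable (hG : IsDegreeOneGraph G)

lemma seg_toArrangement (e : G.edgeSet) : (D.toArrangement hG).seg e = D.edgeSegment e :=
  (D.edgeSegment_eq e).symm

lemma crossings_toArrangement : (D.toArrangement hG).crossings = D.crossings := by
  ext p
  simp only [SegmentArrangement.crossings, crossings, seg_toArrangement, mem_ofPred_eq]
  refine ⟨fun ⟨e, f, h, he, hf⟩ => ⟨?_, e, f, h, he, hf⟩, fun ⟨_, h⟩ => h⟩
  rintro ⟨v, rfl⟩
  exact h (edge_unique hG (D.mem_of_pos_mem_edgeSegment he) (D.mem_of_pos_mem_edgeSegment hf))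

lemma isFace_toArrangement {F : Set Plane} : (D.toArrangement hG).IsFace F ↔ D.IsFace F := by
  simp only [SegmentArrangement.IsFace, IsFace, SegmentArrangement.union, seg_toArrangement]

lemma mem_params_toArrangement [Finite V] {e : G.edgeSet} {t : ℝ} (ht : t ∈ Icc (0 : ℝ) 1) :
    t ∈ (D.toArrangement hG).params e ↔ (D.toArrangement hG).pt e t ∈ D.nodes := by
  set S := D.toArrangement hG with hS
  have hm := S.pt_mem_seg (i := e).2 ht
  simp only [SegmentArrangement.params, Finset.mem_insert, SegmentArrangement.mem_crossParams]
  constructor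
  · rintro (rfl | rfl | ⟨-, j, hj, hjt⟩)
    · exact Or.inl ⟨(endpoints e).1, (S.pt_zero e).symm⟩
    · exact Or.inl ⟨(endpoints e).2, (S.pt_one e).symm⟩
    · right
      rw [← D.crossings_toArrangement hG]
      exact ⟨e, j, hj.symm, hm, hjt⟩
  · rintro (⟨v, hv⟩ | hx)
    · rw [← hv, hS, seg_toArrangement] at hm
      rcases mem_iff_endpoints.1 (D.mem_of_pos_mem_edgeSegment hm) with rfl | rfl
      · left
        exact S.pt_injective e (hv.symm.trans (S.pt_zero e).symm)
      · right; left
        exact S.pt_injective e (hv.symm.trans (S.pt_one e).symm)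
    · right; right
      rw [← D.crossings_toArrangement hG] at hx
      obtain ⟨i, j, hij, hi, hj⟩ := hx
      refine ⟨ht, ?_⟩
      by_cases hie : i = e
      · exact ⟨j, fun h => hij (hie.trans h.symm), hj⟩
      · exact ⟨i, hie, hi⟩

lemma ncard_boundary [Finite V] [Fintype G.edgeSet] (F : Set Plane) :
    {s | s ∈ D.arrangementSegments ∧ s ⊆ facePolygon F}.ncard =
      ∑ e, (D.toArrangement hG).boundaryCount F e := by
  classical
  set S := D.toArrangement hG with hS
  let B : Finset (Σ _ : G.edgeSet, ℝ × ℝ) := Finset.univ.sigma fun e =>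
    {ab ∈ consecutivePairs (S.params e) |
      segment ℝ (S.pt e ab.1) (S.pt e ab.2) ⊆ frontier (closure F)}
  let f : (Σ _ : G.edgeSet, ℝ × ℝ) → Set Plane :=
    fun x => segment ℝ (S.pt x.1 x.2.1) (S.pt x.1 x.2.2)
  have hinj : InjOn f (B : Set (Σ _ : G.edgeSet, ℝ × ℝ)) := by
    rintro ⟨e, ab⟩ h ⟨e', ab'⟩ h' heq
    simp only [B, Finset.coe_sigma, Set.mem_sigma_iff, Finset.mem_coe, Finset.mem_filter] at h h'
    obtain ⟨rfl, rfl⟩ := S.eq_of_segment_eq h.2.1 h'.2.1 heq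
    rfl
  have himage : {s | s ∈ D.arrangementSegments ∧ s ⊆ facePolygon F} =
      f '' (B : Set (Σ _ : G.edgeSet, ℝ × ℝ)) := by
    ext s
    constructor
    · rintro ⟨⟨e, a, b, ha, hb, hae, hbe, hab, hno, rfl⟩, hsub⟩
      rw [← D.seg_toArrangement hG, SegmentArrangement.seg_eq_image] at hae hbe
      obtain ⟨t, ht, rfl⟩ := hae
      obtain ⟨t', ht', rfl⟩ := hbe
      wlog htt : t < t' generalizing t t'
      · have hlt : t' < t := lt_of_le_of_ne (not_lt.1 htt) fun h => hab (by rw [h])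
        have := this t' ht' hb t ht ha hab.symm
          (fun x hx hs => hno x hx hs.symm) (by rwa [segment_symm]) hlt
        rwa [segment_symm] at this
      refine ⟨⟨e, (t, t')⟩, ?_, rfl⟩
      simp only [B, Finset.coe_sigma, Set.mem_sigma_iff, Finset.mem_coe, Finset.mem_filter,
        Finset.mem_univ, true_and, mem_consecutivePairs]
      refine ⟨⟨⟨(D.mem_params_toArrangement hG ht).2 ha, (D.mem_params_toArrangement hG ht').2 hb⟩,
        htt, fun c hc hcc => ?_⟩, hsub⟩
      refine hno (S.pt e c) ((D.mem_params_toArrangement hG (S.params_subset_Icc hc)).1 hc) ?_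
      exact (S.sbtw_pt_iff htt).2 ⟨c, hcc, rfl⟩
    · rintro ⟨⟨e, a, b⟩, h, rfl⟩
      simp only [B, Finset.coe_sigma, Set.mem_sigma_iff, Finset.mem_coe, Finset.mem_filter,
        Finset.mem_univ, true_and, mem_consecutivePairs] at h
      obtain ⟨⟨⟨ha, hb⟩, hab, hno⟩, hsub⟩ := h
      have ha' := S.params_subset_Icc ha
      have hb' := S.params_subset_Icc hb
      refine ⟨⟨e, S.pt e a, S.pt e b, (D.mem_params_toArrangement hG ha').1 ha,
        (D.mem_params_toArrangement hG hb').1 hb, ?_, ?_, (S.pt_injective e).ne hab.ne, ?_, rfl⟩,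
        hsub⟩
      · rw [← D.seg_toArrangement hG]
        exact S.pt_mem_seg.2 ha'
      · rw [← D.seg_toArrangement hG]
        exact S.pt_mem_seg.2 hb'
      · intro x hx hs
        obtain ⟨c, hc, rfl⟩ := (S.sbtw_pt_iff hab).1 hs
        exact hno c ((D.mem_params_toArrangement hG
          ⟨ha'.1.trans hc.1.le, hc.2.le.trans hb'.2⟩).2 hx) hc
  rw [himage, hinj.ncard_image, Set.ncard_coe_finset, Finset.card_sigma]
  rfl

/-- Degree one partitions the vertices into the endpoint pairs of the edges. -/
lemma ncard_vertices [Finite V] [Fintype G.edgeSet] (F : Set Plane) :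
    {v : V | D.pos v ∈ facePolygonInterior F}.ncard =
      ∑ e, (D.toArrangement hG).endCount F e := by
  classical
  have := Fintype.ofFinite V
  choose edgeOf hedge using fun v => (hG v).exists
  let g : V → G.edgeSet := fun v => ⟨edgeOf v, (hedge v).1⟩
  have hset : {v : V | D.pos v ∈ facePolygonInterior F} =
      (({v | D.pos v ∈ facePolygonInterior F} : Finset V) : Set V) := by
    ext v; simp
  rw [hset, Set.ncard_coe_finset, Finset.card_filter, ← Finset.sum_fiberwise Finset.univ g]
  refine Finset.sum_congr rfl fun e _ => ?_
  have hfib : ({v | g v = e} : Finset V) = {(endpoints e).1, (endpoints e).2} := by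
    ext v
    simp only [Finset.mem_filter, Finset.mem_univ, true_and, Finset.mem_insert,
      Finset.mem_singleton, ← mem_iff_endpoints]
    exact ⟨fun h => h ▸ (hedge v).2, fun h => edge_unique hG (hedge v).2 h⟩
  rw [hfib, Finset.sum_pair (endpoints_ne e)]
  rfl

lemma faceComplexity_mod_two [Finite V] {F : Set Plane} (hF : D.IsFace F) :
    D.faceComplexity F % 2 =
      (∑ p ∈ (D.toArrangement hG).crossFinset, (D.toArrangement hG).corners F p) % 2 := by
  have := Fintype.ofFinite G.edgeSet
  rw [← ((D.isFace_toArrangement hG).2 hF).complexity_mod_two, faceComplexity,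
    D.ncard_boundary hG, D.ncard_vertices hG, Finset.sum_add_distrib]

variable {D} in
/-- Without switches, an edge with a bridge has no tunnels. -/
lemma Casing.HasNoSwitches.not_isTunnel [Finite V] {c : D.Casing} (hc : c.HasNoSwitches)
    (hG : IsDegreeOneGraph G) {e : G.edgeSet} {C₁ C₂ : D.crossings} (h₁ : D.IsBridge c e C₁) :
    ¬ D.IsTunnel c e C₂ := by
  intro h₂
  have hfin : Finite D.crossings := by
    rw [← D.crossings_toArrangement hG]
    exact (D.toArrangement hG).finite_crossings
  -- A closest pair of a bridge and a tunnel is consecutive: a crossing strictly between them, being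
  -- one or the other, would form a closer pair.
  obtain ⟨⟨B, T⟩, ⟨hB, hT⟩, hmin⟩ := Set.exists_min_image
    {x : D.crossings × D.crossings | D.IsBridge c e x.1 ∧ D.IsTunnel c e x.2}
    (fun x => dist (x.1 : Plane) x.2) (Set.toFinite _) ⟨(C₁, C₂), h₁, h₂⟩
  have hBT : B ≠ T := by
    rintro rfl
    exact hT.2 hB.2
  refine hc e B T ⟨⟨hB.1, hT.1, hBT, fun C hC => ?_⟩, Or.inl ⟨hB, hT⟩⟩
  have hCe : (C : Plane) ∈ D.edgeSegment e :=
    (convex_convexHull ℝ _).segment_subset hB.1 hT.1 (mem_segment_iff_wbtw.2 hC.wbtw)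
  have hd := hC.wbtw.dist_add_dist
  have hd1 : 0 < dist (B : Plane) C := dist_pos.2 hC.left_ne
  have hd2 : 0 < dist (C : Plane) T := dist_pos.2 hC.ne_right
  by_cases h : (c C : G.edgeSet) = e
  · have := hmin (C, T) ⟨⟨hCe, h⟩, hT⟩
    simp only at this
    linarith
  · have := hmin (B, C) ⟨hB, ⟨hCe, h⟩⟩
    simp only at this
    linarith

/-- The casings without switches come from the proper colourings of the edges with two colours. -/
lemma exists_hasNoSwitches_iff [Finite V] (hG : IsDegreeOneGraph G) : (∃ c : D.Casing, c.HasNoSwitches) ↔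
    ∃ χ : G.edgeSet → Bool, ∀ e f p, e ≠ f → p ∈ D.edgeSegment e → p ∈ D.edgeSegment f →
      χ e ≠ χ f := by
  classical
  constructor
  · rintro ⟨c, hc⟩
    -- An edge is coloured by whether it is ever on top; at a crossing the top edge is, and the
    -- other one, having a tunnel, is not.
    refine ⟨fun e => decide (∃ C, D.IsBridge c e C), fun e f p hef he hf => ?_⟩
    have hp : p ∈ D.crossings := by
      rw [← D.crossings_toArrangement hG]
      exact ⟨e, f, hef, by rwa [seg_toArrangement], by rwa [seg_toArrangement]⟩
    have key : ∀ e f : G.edgeSet, e ≠ f → p ∈ D.edgeSegment e → p ∈ D.edgeSegment f →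
        (c ⟨p, hp⟩ : G.edgeSet) = e →
        (∃ C, D.IsBridge c e C) ∧ ¬ ∃ C, D.IsBridge c f C := by
      intro e f hef he hf hce
      refine ⟨⟨⟨p, hp⟩, he, hce⟩, fun ⟨C, hC⟩ => ?_⟩
      exact hc.not_isTunnel hG hC (C₂ := ⟨p, hp⟩) ⟨hf, by rw [hce]; exact hef⟩
    rcases (D.toArrangement hG).no_triple e f (c ⟨p, hp⟩ : G.edgeSet) p
      ((D.edgeSegment_eq e).subset he) ((D.edgeSegment_eq f).subset hf)
      ((D.edgeSegment_eq _).subset (c ⟨p, hp⟩).2) with h | h | h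
    · exact absurd h hef
    · obtain ⟨h1, h2⟩ := key e f hef he hf h.symm
      simp [h1, h2]
    · obtain ⟨h1, h2⟩ := key f e hef.symm hf he h.symm
      simp [h1, h2]
  · rintro ⟨χ, hχ⟩
    have hex : ∀ C : D.crossings, ∃ e : G.edgeSet, (C : Plane) ∈ D.edgeSegment e ∧ χ e = true := by
      rintro ⟨p, -, e, f, hef, he, hf⟩
      have := hχ e f p hef he hf
      by_cases h : χ e = true
      · exact ⟨e, he, h⟩
      · exact ⟨f, hf, by revert this h; cases χ e <;> cases χ f <;> simp⟩
    choose top htop hcol using hex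
    -- The edge coloured `true` goes on top everywhere.
    let c : D.Casing := fun C => ⟨top C, htop C⟩
    have hBT : ∀ e C₁ C₂, D.IsBridge c e C₁ → ¬ D.IsTunnel c e C₂ := by
      intro e C₁ C₂ h₁ h₂
      have e1 : top C₁ = e := h₁.2
      have e2 : top C₂ ≠ e := h₂.2
      have := hχ _ _ _ e2 (htop C₂) h₂.1
      rw [hcol C₂, ← e1, hcol C₁] at this
      exact this rfl
    refine ⟨c, fun e C₁ C₂ h => ?_⟩
    rcases h.2 with ⟨h1, h2⟩ | ⟨h1, h2⟩
    · exact hBT e _ _ h1 h2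
    · exact hBT e _ _ h2 h1

end StraightLineDrawing

theorem lemma6 {V : Type*} [Finite V] (G : SimpleGraph V) (hG : IsDegreeOneGraph G)
    (D : StraightLineDrawing G) :
    (∃ c : D.Casing, c.HasNoSwitches) ↔ ¬ ∃ F : Set Plane, D.IsOddFacePolygon F := by
  have := Fintype.ofFinite G.edgeSet
  rw [D.exists_hasNoSwitches_iff hG]
  constructor
  · rintro ⟨χ, hχ⟩ ⟨F, hF, -, hodd⟩
    have h := ((D.isFace_toArrangement hG).2 hF).even_corners_of_coloring χ
      (by simpa only [D.seg_toArrangement hG] using hχ)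
    rw [Nat.even_iff, ← D.faceComplexity_mod_two hG hF] at h
    rw [Nat.odd_iff] at hodd
    omega
  · intro hno
    have hcol : (D.toArrangement hG).crossingGraph.Colorable 2 := by
      refine (D.toArrangement hG).crossingGraph_colorable fun F hF hb => ?_
      rw [D.isFace_toArrangement hG] at hF
      rw [Nat.even_iff, ← D.faceComplexity_mod_two hG hF, ← Nat.even_iff, ← Nat.not_odd_iff_even]
      exact fun hodd => hno ⟨F, hF, hb, hodd⟩
    obtain ⟨χ⟩ := hcol
    refine ⟨fun e => decide (χ e = 0), fun e f p hef he hf h => ?_⟩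
    have hadj : (D.toArrangement hG).crossingGraph.Adj e f :=
      ⟨hef, p, by rwa [D.seg_toArrangement hG], by rwa [D.seg_toArrangement hG]⟩
    have hne := χ.valid hadj
    rw [decide_eq_decide] at h
    omega
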